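/- **Setting.** Let $\mathcal P=(\mathcal P,d,\mu)$ be a metric space with a non-atomic Borel regular measure $\mu$ such that $0<\mu(B)<\infty$ for every ball $B=B(x,r)$, $r>0$ (so $\mu$ is $\sigma$-finite). Assume that $\mu$ is doubling: there is $C\ge 1$ with $\mu(B(x,2r))\le C\,\mu(B(x,r))$ for all $x\in\mathcal P$, $r>0$. Let $\mathcal M$ be the set of all $\mu$-measurable functions $u:\mathcal P\to[-\infty,\infty]$, defined everywhere. **Upper gradients.** A Borel function $g:\mathcal P\to[0,\infty]$ is an *upper gradient* of $u:\mathcal P\to[-\infty,\infty]$ if $|u(\gamma(0))-u(\gamma(l))|\le\int_0^{l} g(\gamma(t))\,dt$ for every non-constant rectifiable curve $\gamma:[0,l]\to\mathcal P$ parametrized by arc length, where $|(\pm\infty)-(\pm\infty)|=\infty$. **Poincaré inequality.** $\mathcal P$ is a *$1$-Poincaré space* if there are $c>0$ and $\lambda\ge1$ such that $$\frac1{\mu(B)}\int_B|u-u_B|\,d\mu\le c\,\operatorname{diam}(B)\,\frac1{\mu(\lambda B)}\int_{\lambda B}g\,d\mu ,\qquad u_B=\frac1{\mu(B)}\int_B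 u\,d\mu,$$ for all balls $B=B(x,r)$ (with $\lambda B=B(x,\lambda r)$), all $u\in\mathcal M$ that are integrable on every ball, and all upper gradients $g$ of $u$. **Function spaces.** A *rearrangement-invariant Banach function space* is $X=\{u\in\mathcal M:\|u\|_X<\infty\}$ with a functional $\|\cdot\|_X:\mathcal M\to[0,\infty]$ such that for all $u,v,u_n\in\mathcal M$, $a\in\mathbb R$ and all measurable sets $E$: - $\|u\|_X=0$ if and only if $u=0$ a.e.; $\|au\|_X=|a|\,\|u\|_X$; $\|u+v\|_X\le\|u\|_X+\|v\|_X$; - if $|u|\le|v|$ a.e., then $\|u\|_X\le\|v\|_X$; - if $u_n\ge0$ a.e. for all $n$, then $\|\sum_n u_n\|_X\le\sum_n\|u_n\|_X$; - if $0\le u_n\uparrow u$ a.e., then $\|u_n\|_X\uparrow\|u\|_X$; - if $\mu(E)<\infty$, then $\|\chi_E\|_X<\infty$; - if $\mu(E)<\infty$, then there is $C_E>0$ with $\int_E|w|\,d\mu\le C_E\|w\|_X$ for all $w\in\mathcal M$; - if $\mu(\{|u|>t\})=\mu(\{|v|>t\})$ for all $t\ge0$, then $\|u\|_X=\|v\|_X$.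 Its norm is *absolutely continuous* if, for every $u\in X$, $\|u\chi_{E_n}\|_X\to0$ whenever $(E_n)$ is a decreasing sequence of measurable sets with $\mu(\bigcap_nE_n)=0$. **Newtonian space.** For $u\in\mathcal M$ put $\|u\|_{N^1X}=\|u\|_X+\inf_g\|g\|_X$, the infimum over all upper gradients $g$ of $u$, and $N^1X=\{u\in\mathcal M:\|u\|_{N^1X}<\infty\}$. **Theorem.** If $\mathcal P$ is a $1$-Poincaré space and $X$ is a rearrangement-invariant Banach function space over $(\mathcal P,\mu)$ with absolutely continuous norm, then Lipschitz functions are dense in $N^1X$: for every $u\in N^1X$ and every $\varepsilon>0$ there is a Lipschitz function $f:\mathcal P\to\mathbb R$ with $f\in N^1X$ and $\|u-f\|_{N^1X}<\varepsilon$. -/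

import Mathlib

open MeasureTheory Filter Topology Set
open scoped ENNReal NNReal

namespace NewtonianLip

variable {P : Type*} [MetricSpace P] [MeasurableSpace P]

/-! Extended real-valued `μ`-measurable functions are functions `u : P → EReal` with
`AEMeasurable u μ`, that is, functions measurable with respect to the `μ`-completion of the Borel
sets; `μ`-measurable sets are those with `NullMeasurableSet E μ`. A function norm is a map `N` into
`[0, ∞]`; only its values at `μ`-measurable functions matter. -/

/-- `N` is the norm of a Banach function lattice `X = {u : N u < ∞}` over `(P, μ)`. -/
structure IsBanachFunctionLattice (μ : Measure P) (N : (P → EReal) → ℝ≥0∞) : Prop where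
  eq_zero_iff : ∀ u, AEMeasurable u μ → (N u = 0 ↔ u =ᵐ[μ] 0)
  smul : ∀ (a : ℝ) (u : P → EReal), AEMeasurable u μ →
    N (fun x => (a : EReal) * u x) = ENNReal.ofReal |a| * N u
  /- If both norms are finite, then `u` and `v` are finite a.e., so the value given to `∞ - ∞`
  is immaterial. -/
  add_le : ∀ u v : P → EReal, AEMeasurable u μ → AEMeasurable v μ →
    N (fun x => u x + v x) ≤ N u + N v
  lattice : ∀ u v : P → EReal, AEMeasurable u μ → AEMeasurable v μ →
    (∀ᵐ x ∂μ, (u x).abs ≤ (v x).abs) → N u ≤ N v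
  /- The supremum of the partial sums is the pointwise sum of a series with nonnegative terms. -/
  riesz_fischer : ∀ u : ℕ → P → EReal, (∀ n, AEMeasurable (u n) μ) →
    (∀ n, ∀ᵐ x ∂μ, 0 ≤ u n x) →
    N (fun x => ⨆ n : ℕ, ∑ k ∈ Finset.range n, u k x) ≤ ∑' n, N (u n)

/-- `N` is the norm of a Banach function space over `(P, μ)`. -/
structure IsBanachFunctionSpace (μ : Measure P) (N : (P → EReal) → ℝ≥0∞) : Prop
    extends IsBanachFunctionLattice μ N where
  fatou : ∀ (u : ℕ → P → EReal) (v : P → EReal), (∀ n, AEMeasurable (u n) μ) →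
    AEMeasurable v μ →
    (∀ᵐ x ∂μ, (∀ n, 0 ≤ u n x) ∧ Monotone (fun n => u n x) ∧
      Tendsto (fun n => u n x) atTop (𝓝 (v x))) →
    Monotone (fun n => N (u n)) ∧ Tendsto (fun n => N (u n)) atTop (𝓝 (N v))
  indicator_lt_top : ∀ E : Set P, NullMeasurableSet E μ → μ E < ∞ →
    N (E.indicator (fun _ => (1 : EReal))) < ∞
  lintegral_le : ∀ E : Set P, NullMeasurableSet E μ → μ E < ∞ →
    ∃ C : ℝ≥0, 0 < C ∧ ∀ u : P → EReal, AEMeasurable u μ →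
      ∫⁻ x in E, (u x).abs ∂μ ≤ C * N u

/-- `N` is the norm of a rearrangement-invariant Banach function space over `(P, μ)`:
equimeasurable functions have the same norm. -/
structure IsRearrangementInvariantSpace (μ : Measure P) (N : (P → EReal) → ℝ≥0∞) : Prop
    extends IsBanachFunctionSpace μ N where
  rearrangement : ∀ u v : P → EReal, AEMeasurable u μ → AEMeasurable v μ →
    (∀ t : ℝ≥0, μ {x | (t : ℝ≥0∞) < (u x).abs} = μ {x | (t : ℝ≥0∞) < (v x).abs}) →
    N u = N v

/-- The norm `N` is absolutely continuous. -/
def HasAbsolutelyContinuousNorm (μ : Measure P) (N : (P → EReal) → ℝ≥0∞) : Prop :=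
  ∀ u : P → EReal, AEMeasurable u μ → N u < ∞ →
    ∀ E : ℕ → Set P, (∀ n, NullMeasurableSet (E n) μ) → Antitone E → μ (⋂ n, E n) = 0 →
      Tendsto (fun n => N ((E n).indicator u)) atTop (𝓝 0)

/-- `g` is an upper gradient of `u`. Curves are the nonconstant rectifiable curves, parametrized by
arc length: maps with unit speed on `[0, l]`, where `l > 0` is the length (unit speed makes them
`1`-Lipschitz there). The arithmetic of `EReal` gives `(a - b).abs = ∞` as soon as `a` or `b` is
infinite, including `a = b = ±∞`. -/
def IsUpperGradient (u : P → EReal) (g : P → ℝ≥0∞) : Prop :=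
  Measurable[borel P] g ∧
    ∀ (l : ℝ) (γ : ℝ → P), 0 < l → HasUnitSpeedOn γ (Icc 0 l) →
      (u (γ 0) - u (γ l)).abs ≤ ∫⁻ t in Icc 0 l, g (γ t)

/-- The Newtonian seminorm `‖u‖_{N¹X} = ‖u‖_X + inf_g ‖g‖_X`, the infimum being taken over all
upper gradients `g` of `u`. -/
noncomputable def newtonianNorm (N : (P → EReal) → ℝ≥0∞) (u : P → EReal) : ℝ≥0∞ :=
  N u + ⨅ (g : P → ℝ≥0∞) (_ : IsUpperGradient u g), N (fun x => (g x : EReal))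

/-- The Newtonian space `N¹X`, consisting of functions defined everywhere. -/
def newtonianSpace (μ : Measure P) (N : (P → EReal) → ℝ≥0∞) : Set (P → EReal) :=
  {u | AEMeasurable u μ ∧ newtonianNorm N u < ∞}

/-- `μ` is a doubling measure. -/
def IsDoubling (μ : Measure P) : Prop :=
  ∃ C : ℝ≥0, 1 ≤ C ∧ ∀ (x : P) (r : ℝ), 0 < r →
    μ (Metric.ball x (2 * r)) ≤ C * μ (Metric.ball x r)

/-- `(P, μ)` supports a `p`-Poincaré inequality. Local integrability means integrability on
balls, so that the mean values are well defined. -/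
def SupportsPoincare (μ : Measure P) (p : ℝ) : Prop :=
  ∃ (c : ℝ≥0) (lam : ℝ), 0 < c ∧ 1 ≤ lam ∧
    ∀ (u : P → EReal) (g : P → ℝ≥0∞), AEMeasurable u μ →
      (∀ (x : P) (r : ℝ), 0 < r → ∫⁻ y in Metric.ball x r, (u y).abs ∂μ < ∞) →
      IsUpperGradient u g →
      ∀ (x : P) (r : ℝ), 0 < r →
        ⨍⁻ y in Metric.ball x r,
            (u y - ((⨍ z in Metric.ball x r, (u z).toReal ∂μ : ℝ) : EReal)).abs ∂μ
          ≤ c * Metric.ediam (Metric.ball x r) *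
            (⨍⁻ y in Metric.ball x (lam * r), g y ^ p ∂μ) ^ (1 / p)

end NewtonianLip

/-!
Write `Mg` for the maximal function over balls of radius at most `1`. By absolute continuity of the
norm, truncations of `u` at the levels `±k` converge to `u` in `N¹X`, so let `|v| ≤ k` with an upper
gradient `g ∈ X`, and let `σ ≥ k`. Telescoping the Poincaré inequality over shrinking balls shows
that `v` is `Cσ`-Lipschitz on `{Mg ≤ 2σ}` up to a null set, so it agrees almost everywhere there
with a bounded `Cσ`-Lipschitz function `f` (McShane). An open set `E` containing
`{M(g χ_{g > σ}) > σ}` thus contains almost every point at which `v - f ≠ 0`, and the upper gradient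
`g + Cσ` of `v - f` may be cut down to `E`, whence
`‖v - f‖_{N¹X} ≤ ‖g χ_{g > σ}‖_X + C σ ‖χ_E‖_X`.

What remains is the weak-type estimate `σ ‖χ_E‖_X ≤ C ‖g χ_{g > σ}‖_X`. Replacing a function by its
averages over disjoint sets does not increase a rearrangement-invariant norm more than twofold: when
the sets are cut into pieces of equal measure, the average is the mean of the cyclic permutations of
a step function. Applied to disjoint balls whose enlargements cover `{M(g χ_{g > σ}) > σ}`, this
gives the estimate, and the right-hand side tends to `0` as `σ → ∞`.
-/

namespace NewtonianLip

section Norm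

/-- The norm of a nonnegative function. Working with `[0, ∞]`-valued functions avoids the
undefined sums of `EReal`. -/
noncomputable def posNorm {P : Type*} (N : (P → EReal) → ℝ≥0∞) (g : P → ℝ≥0∞) : ℝ≥0∞ :=
  N fun x => (g x : EReal)

variable {P : Type*} [MeasurableSpace P] {μ : Measure P} {N : (P → EReal) → ℝ≥0∞}

theorem ereal_abs_coe_ennreal (a : ℝ≥0∞) : (a : EReal).abs = a := by
  induction a using ENNReal.recTopCoe with
  | top => rfl
  | coe r =>
    rw [EReal.coe_nnreal_eq_coe_real, EReal.abs_def, NNReal.abs_eq, ENNReal.ofReal_coe_nnreal]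

theorem measurable_ereal_abs : Measurable EReal.abs :=
  EReal.measurable_of_measurable_real measurable_id.abs.ennreal_ofReal

theorem aemeasurable_indicator_one {E : Set P} (hE : MeasurableSet E) :
    AEMeasurable (E.indicator (1 : P → ℝ≥0∞)) μ :=
  (measurable_one.indicator hE).aemeasurable

theorem le_indicator_lt_add {P : Type*} (g : P → ℝ≥0∞) (σ : ℝ≥0∞) (x : P) :
    g x ≤ {x | σ < g x}.indicator g x + σ := by
  by_cases hx : σ < g x
  · rw [indicator_of_mem (show x ∈ {x | σ < g x} from hx)]
    exact le_self_add
  · exact (not_lt.1 hx).trans le_add_self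

namespace IsBanachFunctionLattice

theorem eq_posNorm_abs (hX : IsBanachFunctionLattice μ N) {u : P → EReal}
    (hu : AEMeasurable u μ) : N u = posNorm N fun x => (u x).abs := by
  have hu_abs : AEMeasurable (fun x => ((u x).abs : EReal)) μ :=
    (measurable_ereal_abs.comp_aemeasurable hu).coe_ereal_ennreal
  refine le_antisymm (hX.lattice _ _ hu hu_abs ?_) (hX.lattice _ _ hu_abs hu ?_) <;>
  · filter_upwards with x
    rw [ereal_abs_coe_ennreal]

theorem posNorm_mono (hX : IsBanachFunctionLattice μ N) {f g : P → ℝ≥0∞}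
    (hf : AEMeasurable f μ) (hg : AEMeasurable g μ) (h : f ≤ᵐ[μ] g) :
    posNorm N f ≤ posNorm N g := by
  refine hX.lattice _ _ hf.coe_ereal_ennreal hg.coe_ereal_ennreal ?_
  filter_upwards [h] with x hx
  simpa only [ereal_abs_coe_ennreal] using hx

theorem posNorm_congr (hX : IsBanachFunctionLattice μ N) {f g : P → ℝ≥0∞}
    (hf : AEMeasurable f μ) (h : f =ᵐ[μ] g) : posNorm N f = posNorm N g :=
  le_antisymm (hX.posNorm_mono hf (hf.congr h) h.le) (hX.posNorm_mono (hf.congr h) hf h.symm.le)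

theorem posNorm_add_le (hX : IsBanachFunctionLattice μ N) {f g : P → ℝ≥0∞}
    (hf : AEMeasurable f μ) (hg : AEMeasurable g μ) :
    posNorm N (fun x => f x + g x) ≤ posNorm N f + posNorm N g := by
  simpa only [posNorm, EReal.coe_ennreal_add]
    using hX.add_le _ _ hf.coe_ereal_ennreal hg.coe_ereal_ennreal

theorem posNorm_const_mul (hX : IsBanachFunctionLattice μ N) {f : P → ℝ≥0∞}
    (hf : AEMeasurable f μ) (c : ℝ≥0) :
    posNorm N (fun x => c * f x) = c * posNorm N f := by
  have hsmul := hX.smul c _ hf.coe_ereal_ennreal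
  rw [NNReal.abs_eq, ENNReal.ofReal_coe_nnreal] at hsmul
  simpa only [posNorm, EReal.coe_ennreal_mul, EReal.coe_nnreal_eq_coe_real] using hsmul

theorem posNorm_zero (hX : IsBanachFunctionLattice μ N) : posNorm N (fun _ => 0) = 0 :=
  (hX.eq_zero_iff _ aemeasurable_const.coe_ereal_ennreal).2 (by rfl)

theorem posNorm_sum_le (hX : IsBanachFunctionLattice μ N) {ι : Type*} (s : Finset ι)
    (f : ι → P → ℝ≥0∞) (hf : ∀ i, AEMeasurable (f i) μ) :
    posNorm N (fun x => ∑ i ∈ s, f i x) ≤ ∑ i ∈ s, posNorm N (f i) := by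
  classical
  induction s using Finset.induction_on with
  | empty => simp [hX.posNorm_zero]
  | insert a s ha ih =>
    simp only [Finset.sum_insert ha]
    exact (hX.posNorm_add_le (hf a) (Finset.aemeasurable_fun_sum s fun i _ => hf i)).trans
      (by gcongr)

theorem posNorm_indicator_mono (hX : IsBanachFunctionLattice μ N) {E F : Set P}
    (hE : MeasurableSet E) (hF : MeasurableSet F) (h : E ⊆ F) :
    posNorm N (E.indicator 1) ≤ posNorm N (F.indicator 1) :=
  hX.posNorm_mono (aemeasurable_indicator_one hE) (aemeasurable_indicator_one hF)
    (Eventually.of_forall (indicator_le_indicator_of_subset h fun _ => zero_le))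

theorem posNorm_indicator_const (hX : IsBanachFunctionLattice μ N) {E : Set P}
    (hE : MeasurableSet E) (c : ℝ≥0) :
    posNorm N (E.indicator fun _ => (c : ℝ≥0∞)) = c * posNorm N (E.indicator 1) := by
  rw [← hX.posNorm_const_mul (aemeasurable_indicator_one hE)]
  congr 1
  ext x
  by_cases hx : x ∈ E <;> simp [hx]

theorem posNorm_indicator_union_le (hX : IsBanachFunctionLattice μ N) {E F : Set P}
    (hE : MeasurableSet E) (hF : MeasurableSet F) :
    posNorm N ((E ∪ F).indicator 1) ≤ posNorm N (E.indicator 1) + posNorm N (F.indicator 1) := by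
  refine (hX.posNorm_mono (aemeasurable_indicator_one (hE.union hF))
    ((aemeasurable_indicator_one hE).add (aemeasurable_indicator_one hF))
    (Eventually.of_forall fun x => ?_)).trans
    (hX.posNorm_add_le (aemeasurable_indicator_one hE) (aemeasurable_indicator_one hF))
  by_cases hxE : x ∈ E <;> by_cases hxF : x ∈ F <;> simp [hxE, hxF]

theorem posNorm_indicator_add_const_le (hX : IsBanachFunctionLattice μ N) {g : P → ℝ≥0∞}
    (hg : Measurable g) {E : Set P} (hE : MeasurableSet E) (σ c : ℝ≥0) :
    posNorm N (E.indicator fun x => g x + c) ≤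
      posNorm N ({x | σ < g x}.indicator g) + (σ + c) * posNorm N (E.indicator 1) := by
  have hg_lt : AEMeasurable ({x | (σ : ℝ≥0∞) < g x}.indicator g) μ :=
    (hg.indicator (measurableSet_lt measurable_const hg)).aemeasurable
  have hconst : AEMeasurable (E.indicator fun _ => ((σ + c : ℝ≥0) : ℝ≥0∞)) μ :=
    aemeasurable_const.indicator hE
  rw [← ENNReal.coe_add, ← hX.posNorm_indicator_const hE]
  refine (hX.posNorm_mono ((hg.add measurable_const).indicator hE).aemeasurable
    (hg_lt.add hconst) (Eventually.of_forall fun x => ?_)).trans (hX.posNorm_add_le hg_lt hconst)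
  by_cases hxE : x ∈ E
  · simpa [hxE, add_assoc] using add_le_add_left (le_indicator_lt_add g σ x) (c : ℝ≥0∞)
  · simp [hxE]

end IsBanachFunctionLattice

theorem IsBanachFunctionSpace.posNorm_indicator_iUnion_le (hX : IsBanachFunctionSpace μ N)
    {E : ℕ → Set P} (hE : ∀ n, MeasurableSet (E n)) (hmono : Monotone E) {c : ℝ≥0∞}
    (h : ∀ n, posNorm N ((E n).indicator 1) ≤ c) :
    posNorm N ((⋃ n, E n).indicator 1) ≤ c := by
  refine le_of_tendsto' (hX.fatou _ _
    (fun n => (aemeasurable_indicator_one (hE n)).coe_ereal_ennreal)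
    (aemeasurable_indicator_one (MeasurableSet.iUnion hE)).coe_ereal_ennreal ?_).2 h
  filter_upwards with x
  refine ⟨fun n => EReal.coe_ennreal_nonneg _, fun m n hmn => ?_, ?_⟩
  · exact EReal.coe_ennreal_le_coe_ennreal_iff.2
      (indicator_le_indicator_of_subset (hmono hmn) (fun _ => zero_le) x)
  · exact (continuous_coe_ennreal_ereal.tendsto _).comp
      ((hmono.tendsto_indicator E 1 x).mono_right (pure_le_nhds _))

theorem IsRearrangementInvariantSpace.posNorm_eq_of_measure_lt_eq
    (hX : IsRearrangementInvariantSpace μ N) {f g : P → ℝ≥0∞}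
    (hf : AEMeasurable f μ) (hg : AEMeasurable g μ)
    (h : ∀ t : ℝ≥0, μ {x | (t : ℝ≥0∞) < f x} = μ {x | (t : ℝ≥0∞) < g x}) :
    posNorm N f = posNorm N g := by
  refine hX.rearrangement _ _ hf.coe_ereal_ennreal hg.coe_ereal_ennreal fun t => ?_
  simpa only [ereal_abs_coe_ennreal] using h t

theorem HasAbsolutelyContinuousNorm.tendsto_posNorm_indicator
    (hAC : HasAbsolutelyContinuousNorm μ N) {f : P → ℝ≥0∞} (hf : AEMeasurable f μ)
    (hfin : posNorm N f < ∞) {E : ℕ → Set P} (hE : ∀ n, NullMeasurableSet (E n) μ)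
    (hanti : Antitone E) (hnull : μ (⋂ n, E n) = 0) :
    Tendsto (fun n => posNorm N ((E n).indicator f)) atTop (𝓝 0) := by
  refine (hAC _ hf.coe_ereal_ennreal hfin E hE hanti hnull).congr fun n => ?_
  congr 1
  ext x
  by_cases hx : x ∈ E n <;> simp [hx]

end Norm

section MeasureValues

variable {P : Type*} [MeasurableSpace P] {μ : Measure P}

theorem isOpenPosMeasure_of_measure_ball_pos [PseudoMetricSpace P]
    (hball : ∀ (x : P) (r : ℝ), 0 < r → 0 < μ (Metric.ball x r)) : μ.IsOpenPosMeasure := by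
  refine ⟨fun U hU ⟨x, hx⟩ => ?_⟩
  obtain ⟨r, hr, hrU⟩ := Metric.isOpen_iff.1 hU x hx
  exact ((hball x r hr).trans_le (measure_mono hrU)).ne'

theorem sigmaFinite_of_measure_ball_lt_top [PseudoMetricSpace P]
    (hball : ∀ (x : P) (r : ℝ), μ (Metric.ball x r) < ∞) : SigmaFinite μ := by
  rcases isEmpty_or_nonempty P with hP | ⟨⟨x₀⟩⟩
  · rw [Measure.eq_zero_of_isEmpty μ]
    infer_instance
  · exact ⟨⟨⟨fun n => Metric.ball x₀ n, fun _ => trivial, fun n => hball x₀ n,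
      Metric.iUnion_ball_nat x₀⟩⟩⟩

theorem secondCountableTopology_of_isOpenPosMeasure [PseudoMetricSpace P] [OpensMeasurableSpace P]
    (μ : Measure P) [SFinite μ] [μ.IsOpenPosMeasure] : SecondCountableTopology P := by
  refine Metric.secondCountable_of_almost_dense_set fun ε hε => ?_
  obtain ⟨s, -, hdisj, hcover⟩ := Vitali.exists_disjoint_subfamily_covering_enlargement_closedBall
    (univ : Set P) id (fun _ => ε / 5) (ε / 5) (fun _ _ => le_rfl) 5 (by norm_num)
  refine ⟨s, ?_, fun x => ?_⟩
  · have hcount := Measure.countable_meas_pos_of_disjoint_iUnion (μ := μ)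
      (As := fun x : s => Metric.closedBall (x : P) (ε / 5))
      (fun _ => Metric.isClosed_closedBall.measurableSet)
      (fun a b hab => hdisj a.2 b.2 (Subtype.coe_injective.ne hab))
    have hpos : {i : s | 0 < μ (Metric.closedBall (i : P) (ε / 5))} = univ :=
      eq_univ_of_forall fun i => Metric.measure_closedBall_pos μ _ (by positivity)
    rw [hpos, countable_univ_iff] at hcount
    exact countable_coe_iff.1 hcount
  · obtain ⟨y, hy, hsub⟩ := hcover x (mem_univ _)
    have hx := hsub (Metric.mem_closedBall_self (by positivity))
    rw [Metric.mem_closedBall, mul_div_cancel₀ _ (by norm_num)] at hx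
    exact ⟨y, hy, hx⟩

theorem exists_measure_Iic_eq (ν : Measure ℝ) [IsFiniteMeasure ν] [NullSingletonClass ν]
    {t : ℝ≥0∞} (ht0 : t ≠ 0) (ht : t < ν univ) : ∃ a, ν (Iic a) = t := by
  have hcont : Continuous fun a => ν.real (Iic a) := by
    refine continuous_iff_continuousAt.2 fun a => ?_
    have hprim := IntegrableOn.continuousOn_Iic_primitive_Iic (μ := ν)
      (f := fun _ : ℝ => (1 : ℝ)) (a₀ := a + 1) (integrable_const _).integrableOn
    simpa using hprim.continuousAt (Iic_mem_nhds (by linarith))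
  have hbot : Tendsto (fun a => ν (Iic a)) atBot (𝓝 0) := by
    have hInter := tendsto_measure_iInter_atBot (μ := ν) (s := fun a : ℝ => Iic a)
      (fun _ => measurableSet_Iic.nullMeasurableSet) (fun _ _ hab => Iic_subset_Iic.2 hab)
      ⟨0, measure_ne_top _ _⟩
    rwa [iInter_Iic_eq_empty_iff.2 (by simp [not_bddBelow_univ]), measure_empty] at hInter
  obtain ⟨b, hb⟩ := (hbot.eventually_lt_const ht0.bot_lt).exists
  obtain ⟨c, hc⟩ := ((tendsto_measure_Iic_atTop ν).eventually_const_lt ht).exists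
  obtain ⟨a, ha⟩ := mem_range_of_exists_le_of_exists_ge hcont (c := t.toReal)
    ⟨b, ENNReal.toReal_mono ht.ne_top hb.le⟩ ⟨c, ENNReal.toReal_mono (measure_ne_top _ _) hc.le⟩
  exact ⟨a, (ENNReal.toReal_eq_toReal_iff' (measure_ne_top _ _) ht.ne_top).1 ha⟩

variable [MeasurableSpace.CountablySeparated P] [NullSingletonClass μ]

theorem exists_subset_measure_eq {E : Set P} (hE : MeasurableSet E) (hfin : μ E < ∞) {t : ℝ≥0∞}
    (ht : t ≤ μ E) : ∃ F ⊆ E, MeasurableSet F ∧ μ F = t := by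
  rcases eq_or_ne t 0 with rfl | ht0
  · exact ⟨∅, empty_subset _, MeasurableSet.empty, measure_empty⟩
  rcases ht.eq_or_lt with rfl | ht'
  · exact ⟨E, Subset.rfl, hE, rfl⟩
  obtain ⟨φ, hφ, hφ_inj⟩ := MeasurableSpace.measurable_injection_nat_bool_of_countablySeparated P
  set h : P → ℝ := fun x => embeddingReal (ℕ → Bool) (φ x)
  have hm : Measurable h := (measurable_embeddingReal _).comp hφ
  have hinj : Function.Injective h := (measurableEmbedding_embeddingReal _).injective.comp hφ_inj
  set ν : Measure ℝ := (μ.restrict E).map h with hν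
  have : IsFiniteMeasure (μ.restrict E) := ⟨by simpa using hfin⟩
  have hν_apply : ∀ s, MeasurableSet s → ν s = μ (h ⁻¹' s ∩ E) := fun s hs => by
    rw [hν, Measure.map_apply hm hs, Measure.restrict_apply (hm hs)]
  have : NullSingletonClass ν := ⟨fun a => by
    rw [hν_apply _ (measurableSet_singleton a)]
    exact measure_mono_null inter_subset_left
      ((subsingleton_singleton.preimage hinj).measure_zero μ)⟩
  obtain ⟨a, ha⟩ := exists_measure_Iic_eq ν ht0 (by simpa [hν_apply _ MeasurableSet.univ] using ht')
  exact ⟨h ⁻¹' Iic a ∩ E, inter_subset_right, (hm measurableSet_Iic).inter hE,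
    by rw [← hν_apply _ measurableSet_Iic, ha]⟩

theorem exists_disjoint_subsets_measure_eq {t : ℝ≥0∞} (k : ℕ) {S : Set P}
    (hS : MeasurableSet S) (hfin : μ S < ∞) (h : k * t ≤ μ S) :
    ∃ Q : Fin k → Set P, (∀ i, MeasurableSet (Q i)) ∧ Pairwise (Function.onFun Disjoint Q) ∧
      (∀ i, Q i ⊆ S) ∧ ∀ i, μ (Q i) = t := by
  induction k generalizing S with
  | zero => exact ⟨fun _ => ∅, fun i => i.elim0, fun i => i.elim0, fun i => i.elim0,
      fun i => i.elim0⟩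
  | succ k ih =>
    have hle : t ≤ μ S := (le_mul_of_one_le_left' (by simp)).trans h
    have ht : t ≠ ∞ := (hle.trans_lt hfin).ne
    obtain ⟨F, hFS, hF, hFt⟩ := exists_subset_measure_eq hS hfin hle
    have hdiff : k * t ≤ μ (S \ F) := by
      rw [measure_sdiff hFS hF.nullMeasurableSet (hFt ▸ ht), hFt]
      refine ENNReal.le_sub_of_add_le_right ht (le_trans (le_of_eq ?_) h)
      push_cast
      ring
    obtain ⟨Q, hQ, hd, hQS, hQt⟩ :=
      ih (hS.diff hF) ((measure_mono sdiff_subset).trans_lt hfin) hdiff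
    have hdF : ∀ i, Disjoint F (Q i) := fun i => disjoint_sdiff_right.mono_right (hQS i)
    refine ⟨Fin.cons F Q, Fin.cases hF hQ, ?_, Fin.cases hFS fun i => (hQS i).trans sdiff_subset,
      Fin.cases hFt hQt⟩
    intro i j
    refine Fin.cases ?_ (fun i => ?_) i <;> refine Fin.cases ?_ (fun j => ?_) j
    · exact fun h => absurd rfl h
    · exact fun _ => hdF j
    · exact fun _ => (hdF i).symm
    · exact fun h => hd fun hij => h (congrArg Fin.succ hij)

theorem exists_packing {t : ℝ≥0} (ht : 0 < t) {S : Set P} (hS : MeasurableSet S)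
    (hfin : μ S < ∞) :
    ∃ (k : ℕ) (Q : Fin k → Set P), (∀ i, MeasurableSet (Q i)) ∧
      Pairwise (Function.onFun Disjoint Q) ∧ (∀ i, Q i ⊆ S) ∧ (∀ i, μ (Q i) = t) ∧
      μ S ≤ k * t + t := by
  lift μ S to ℝ≥0 using hfin.ne with m hm
  have hfloor : (⌊m / t⌋₊ : ℝ≥0) * t ≤ m := (le_div_iff₀ ht).1 (Nat.floor_le zero_le)
  have hfloor' : m ≤ ⌊m / t⌋₊ * t + t := by
    rw [← add_one_mul, ← div_le_iff₀ ht]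
    exact (Nat.lt_floor_add_one (m / t)).le
  obtain ⟨Q, hQ, hd, hQS, hQt⟩ := exists_disjoint_subsets_measure_eq (μ := μ) (t := t)
    ⌊m / t⌋₊ hS (hm ▸ ENNReal.coe_lt_top) (by rw [← hm]; exact_mod_cast hfloor)
  exact ⟨_, Q, hQ, hd, hQS, hQt, mod_cast hfloor'⟩

end MeasureValues

section StepFunction

variable {P ι : Type*} [Fintype ι] {Q : ι → Set P}

/-- The step function with value `a i` on `Q i`, for disjoint sets `Q i`, and value `0`
elsewhere. -/
noncomputable def stepFun (Q : ι → Set P) (a : ι → ℝ≥0∞) (x : P) : ℝ≥0∞ :=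
  ∑ i, (Q i).indicator (fun _ => a i) x

theorem stepFun_of_mem (hd : Pairwise (Function.onFun Disjoint Q)) (a : ι → ℝ≥0∞) {x : P} {i : ι}
    (hx : x ∈ Q i) : stepFun Q a x = a i := by
  rw [stepFun, Finset.sum_eq_single i, indicator_of_mem hx]
  · intro j _ hji
    exact indicator_of_notMem (fun hj => (hd hji).le_bot ⟨hj, hx⟩) _
  · simp

theorem stepFun_of_notMem (a : ι → ℝ≥0∞) {x : P} (hx : x ∉ ⋃ i, Q i) : stepFun Q a x = 0 :=
  Finset.sum_eq_zero fun i _ => indicator_of_notMem (fun hi => hx (mem_iUnion.2 ⟨i, hi⟩)) _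

theorem stepFun_le (hd : Pairwise (Function.onFun Disjoint Q)) {a : ι → ℝ≥0∞} {g : P → ℝ≥0∞}
    (h : ∀ i, ∀ x ∈ Q i, a i ≤ g x) : stepFun Q a ≤ g := by
  intro x
  by_cases hx : x ∈ ⋃ i, Q i
  · obtain ⟨i, hi⟩ := mem_iUnion.1 hx
    exact (stepFun_of_mem hd a hi).trans_le (h i x hi)
  · exact (stepFun_of_notMem a hx).trans_le zero_le

variable [MeasurableSpace P] {μ : Measure P} {N : (P → EReal) → ℝ≥0∞}

theorem measurable_stepFun (hQ : ∀ i, MeasurableSet (Q i)) (a : ι → ℝ≥0∞) :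
    Measurable (stepFun Q a) :=
  Finset.measurable_fun_sum _ fun i _ => measurable_const.indicator (hQ i)

theorem measure_lt_stepFun (hQ : ∀ i, MeasurableSet (Q i))
    (hd : Pairwise (Function.onFun Disjoint Q)) (a : ι → ℝ≥0∞) (s : ℝ≥0∞) :
    μ {x | s < stepFun Q a x} = ∑ i, if s < a i then μ (Q i) else 0 := by
  have hset : {x | s < stepFun Q a x} = ⋃ i ∈ Finset.univ.filter fun i => s < a i, Q i := by
    ext x
    simp only [mem_ofPred_eq, mem_iUnion, Finset.mem_filter, Finset.mem_univ, true_and, exists_prop]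
    constructor
    · intro hx
      obtain ⟨i, hi⟩ : ∃ i, x ∈ Q i := by
        by_contra! hx'
        simp [stepFun_of_notMem a (by simpa using hx')] at hx
      exact ⟨i, stepFun_of_mem hd a hi ▸ hx, hi⟩
    · rintro ⟨i, hi, hxi⟩
      rwa [stepFun_of_mem hd a hxi]
  rw [hset, measure_biUnion_finset (fun i _ j _ hij => hd hij) (fun i _ => hQ i),
    Finset.sum_filter]

theorem posNorm_stepFun_comp_perm (hX : IsRearrangementInvariantSpace μ N)
    (hQ : ∀ i, MeasurableSet (Q i)) (hd : Pairwise (Function.onFun Disjoint Q)) {t : ℝ≥0∞}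
    (ht : ∀ i, μ (Q i) = t) (a : ι → ℝ≥0∞) (τ : Equiv.Perm ι) :
    posNorm N (stepFun Q (a ∘ τ)) = posNorm N (stepFun Q a) := by
  refine hX.posNorm_eq_of_measure_lt_eq (measurable_stepFun hQ _).aemeasurable
    (measurable_stepFun hQ _).aemeasurable fun s => ?_
  simp only [measure_lt_stepFun hQ hd, ht]
  exact Equiv.sum_comp τ fun i => if (s : ℝ≥0∞) < a i then t else 0

-- Summing the step function over all cyclic permutations of its values gives a multiple of
-- `χ_{⋃ Q}`.
theorem sum_mul_posNorm_indicator_iUnion_le (hX : IsRearrangementInvariantSpace μ N)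
    (hQ : ∀ i, MeasurableSet (Q i)) (hd : Pairwise (Function.onFun Disjoint Q)) {t : ℝ≥0∞}
    (ht : ∀ i, μ (Q i) = t) (a : ι → ℝ≥0) :
    (∑ i, a i : ℝ≥0) * posNorm N ((⋃ i, Q i).indicator 1) ≤
      Fintype.card ι * posNorm N (stepFun Q fun i => a i) := by
  rcases isEmpty_or_nonempty ι with hι | hι
  · simp
  have : NeZero (Fintype.card ι) := ⟨Fintype.card_ne_zero⟩
  let _ : AddGroup ι := (Fintype.equivOfCardEq (ZMod.card (Fintype.card ι)).symm).addGroup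
  let shift (c : ι) : P → ℝ≥0∞ := stepFun Q ((fun i => (a i : ℝ≥0∞)) ∘ Equiv.addRight c)
  have hsum : ∀ x, ∑ c, shift c x = (∑ i, a i : ℝ≥0) * (⋃ i, Q i).indicator 1 x := by
    intro x
    by_cases hx : x ∈ ⋃ i, Q i
    · obtain ⟨i, hi⟩ := mem_iUnion.1 hx
      rw [indicator_of_mem hx, Pi.one_apply, mul_one, ENNReal.ofNNReal_finsetSum]
      exact (Finset.sum_congr rfl fun c _ => stepFun_of_mem hd _ hi).trans
        (Equiv.sum_comp (Equiv.addLeft i) fun j => (a j : ℝ≥0∞))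
    · rw [indicator_of_notMem hx, mul_zero]
      exact Finset.sum_eq_zero fun c _ => stepFun_of_notMem _ hx
  calc (∑ i, a i : ℝ≥0) * posNorm N ((⋃ i, Q i).indicator 1)
      = posNorm N (fun x => ∑ c, shift c x) := by
        rw [← hX.posNorm_const_mul (aemeasurable_indicator_one (MeasurableSet.iUnion hQ))]
        simp only [hsum]
    _ ≤ ∑ c, posNorm N (shift c) :=
        hX.posNorm_sum_le _ _ fun c => (measurable_stepFun hQ _).aemeasurable
    _ = Fintype.card ι * posNorm N (stepFun Q fun i => a i) := by
        simp only [shift, posNorm_stepFun_comp_perm hX hQ hd ht, Finset.sum_const, nsmul_eq_mul,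
          Finset.card_univ]

end StepFunction

section Averaging

variable {P : Type*} [MeasurableSpace P] {μ : Measure P} {N : (P → EReal) → ℝ≥0∞}
  [MeasurableSpace.CountablySeparated P] [NullSingletonClass μ]

namespace IsRearrangementInvariantSpace

theorem posNorm_indicator_le_of_measure_le (hX : IsRearrangementInvariantSpace μ N)
    {E A : Set P} (hE : MeasurableSet E) (hA : MeasurableSet A) (hAfin : μ A < ∞)
    (h : μ E ≤ μ A) : posNorm N (E.indicator 1) ≤ posNorm N (A.indicator 1) := by
  obtain ⟨F, hFA, hF, hFE⟩ := exists_subset_measure_eq hA hAfin h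
  have hset : ∀ (S : Set P) (t : ℝ≥0), {x | (t : ℝ≥0∞) < S.indicator 1 x} =
      if t < 1 then S else ∅ := by
    intro S t
    ext x
    by_cases hx : x ∈ S <;> by_cases ht : t < 1 <;> simp [hx, ht]
  refine (hX.posNorm_eq_of_measure_lt_eq (aemeasurable_indicator_one hE)
    (aemeasurable_indicator_one hF) fun t => ?_).trans_le (hX.posNorm_indicator_mono hF hA hFA)
  rw [hset, hset]
  split_ifs
  · exact hFE.symm
  · rfl

theorem posNorm_indicator_le_of_measure_le_mul (hX : IsRearrangementInvariantSpace μ N)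
    {A : Set P} (hA : MeasurableSet A) (hAfin : μ A < ∞) (m : ℕ) {E : Set P}
    (hE : MeasurableSet E) (h : μ E ≤ m * μ A) :
    posNorm N (E.indicator 1) ≤ m * posNorm N (A.indicator 1) := by
  induction m generalizing E with
  | zero =>
    have hempty := hX.posNorm_indicator_le_of_measure_le hE MeasurableSet.empty (by simp)
      (by simpa using h)
    rw [indicator_empty] at hempty
    simpa using hempty.trans_eq hX.posNorm_zero
  | succ m ih =>
    rcases le_total (μ E) (μ A) with hEA | hAE
    · refine (hX.posNorm_indicator_le_of_measure_le hE hA hAfin hEA).trans ?_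
      exact le_mul_of_one_le_left' (by simp)
    · have hEfin : μ E < ∞ := h.trans_lt (ENNReal.mul_lt_top (ENNReal.natCast_lt_top _) hAfin)
      obtain ⟨F, hFE, hF, hFA⟩ := exists_subset_measure_eq hE hEfin hAE
      have hdiff : μ (E \ F) ≤ m * μ A := by
        rw [measure_sdiff hFE hF.nullMeasurableSet (hFA ▸ hAfin.ne), hFA]
        refine tsub_le_iff_right.2 (h.trans_eq ?_)
        push_cast
        ring
      calc posNorm N (E.indicator 1)
          = posNorm N ((E \ F ∪ F).indicator 1) := by rw [sdiff_union_of_subset hFE]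
        _ ≤ posNorm N ((E \ F).indicator 1) + posNorm N (F.indicator 1) :=
            hX.posNorm_indicator_union_le (hE.diff hF) hF
        _ ≤ m * posNorm N (A.indicator 1) + posNorm N (A.indicator 1) :=
            add_le_add (ih (hE.diff hF) hdiff)
              (hX.posNorm_indicator_le_of_measure_le hF hA hAfin hFA.le)
        _ = (m + 1 : ℕ) * posNorm N (A.indicator 1) := by push_cast; ring

theorem measure_mul_posNorm_indicator_le (hX : IsRearrangementInvariantSpace μ N)
    {U A : Set P} (hU : MeasurableSet U) (hA : MeasurableSet A) (hAfin : μ A < ∞)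
    (h : μ U ≤ μ A) :
    μ U * posNorm N (A.indicator 1) ≤ 2 * μ A * posNorm N (U.indicator 1) := by
  have hUfin := h.trans_lt hAfin
  rcases eq_or_ne (μ U) 0 with hU0 | hU0
  · simp [hU0]
  obtain ⟨m, hm, hm'⟩ : ∃ m : ℕ, μ A ≤ m * μ U ∧ m * μ U ≤ 2 * μ A := by
    lift μ U to ℝ≥0 using hUfin.ne with s
    lift μ A to ℝ≥0 using hAfin.ne with r
    norm_cast at h hU0 ⊢
    have hs : 0 < s := pos_iff_ne_zero.2 hU0
    refine ⟨⌈r / s⌉₊, (div_le_iff₀ hs).1 (Nat.le_ceil _), ?_⟩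
    calc ⌈r / s⌉₊ * s ≤ (r / s + 1) * s := by gcongr; exact (Nat.ceil_lt_add_one zero_le).le
      _ = r + s := by field_simp
      _ ≤ 2 * r := by rw [two_mul]; gcongr
  calc μ U * posNorm N (A.indicator 1)
      ≤ μ U * (m * posNorm N (U.indicator 1)) := by
        gcongr
        exact hX.posNorm_indicator_le_of_measure_le_mul hU hUfin m hA hm
    _ = m * μ U * posNorm N (U.indicator 1) := by ring
    _ ≤ 2 * μ A * posNorm N (U.indicator 1) := by gcongr

end IsRearrangementInvariantSpace

theorem exists_equimeasurable_packing (φ : SimpleFunc P ℝ≥0) {A : Set P} (hA : MeasurableSet A)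
    (hAfin : μ A < ∞) {t : ℝ≥0} (ht : 0 < t) :
    ∃ (k : φ.range → ℕ) (R : (Σ v, Fin (k v)) → Set P), (∀ i, MeasurableSet (R i)) ∧
      Pairwise (Function.onFun Disjoint R) ∧ (∀ i, R i ⊆ A) ∧ (∀ i, μ (R i) = t) ∧
      (∀ i, ∀ x ∈ R i, φ x = i.1) ∧ ∀ v, μ (φ ⁻¹' {v.1} ∩ A) ≤ k v * t + t := by
  choose k Q hQm hQd hQS hQt hQk using fun v : φ.range =>
    exists_packing (μ := μ) ht ((φ.measurableSet_fiber v).inter hA)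
      ((measure_mono inter_subset_right).trans_lt hAfin)
  have hφ : ∀ v i, ∀ x ∈ Q v i, φ x = v := fun v i x hx => (hQS v i hx).1
  refine ⟨k, fun i => Q i.1 i.2, fun i => hQm _ _, ?_,
    fun i => (hQS _ _).trans inter_subset_right, fun i => hQt _ _, fun i => hφ _ _, hQk⟩
  rintro ⟨v, i⟩ ⟨w, j⟩ hij
  rcases eq_or_ne v w with rfl | hvw
  · exact hQd v fun h => hij (congrArg (Sigma.mk v) h)
  · exact Set.disjoint_left.2 fun x hx hy =>
      hvw (Subtype.ext ((hφ v i x hx).symm.trans (hφ w j x hy)))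

theorem exists_equimeasurable_minorant_of_lt_lintegral {A : Set P} (hA : MeasurableSet A)
    (hAfin : μ A < ∞) {g : P → ℝ≥0∞} {c : ℝ≥0∞} (h : c < ∫⁻ x in A, g x ∂μ) :
    ∃ (ι : Type) (_ : Fintype ι) (R : ι → Set P) (a : ι → ℝ≥0) (t : ℝ≥0),
      (∀ i, MeasurableSet (R i)) ∧ Pairwise (Function.onFun Disjoint R) ∧ (∀ i, R i ⊆ A) ∧
      (∀ i, μ (R i) = t) ∧ (∀ i, ∀ x ∈ R i, (a i : ℝ≥0∞) ≤ g x) ∧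
      c < (∑ i, a i : ℝ≥0) * t := by
  simp only [lintegral_eq_nnreal, lt_iSup_iff, SimpleFunc.map_lintegral] at h
  obtain ⟨φ, hφ, hlt⟩ := h
  obtain ⟨δ, hδ, hslack⟩ := ENNReal.lt_iff_exists_add_pos_lt.1 hlt
  set t : ℝ≥0 := δ / (∑ v ∈ φ.range, v + 1) with ht_def
  have ht : 0 < t := by positivity
  have htδ : (∑ v ∈ φ.range, v) * t ≤ δ := by
    rw [ht_def, mul_div_assoc', div_le_iff₀ (by positivity), mul_comm]
    gcongr
    exact le_self_add
  obtain ⟨k, R, hRm, hRd, hRA, hRt, hRφ, hk⟩ := exists_equimeasurable_packing φ hA hAfin ht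
  refine ⟨_, inferInstance, R, fun i => i.1, t, hRm, hRd, hRA, hRt,
    fun i x hx => by simpa [hRφ i x hx] using hφ x, lt_of_add_lt_add_right (hslack.trans_le ?_)⟩
  calc ∑ v ∈ φ.range, (v : ℝ≥0∞) * μ.restrict A (φ ⁻¹' {v})
      = ∑ v : φ.range, (v : ℝ≥0∞) * μ (φ ⁻¹' {v.1} ∩ A) := by
        rw [← Finset.sum_coe_sort]
        simp only [Measure.restrict_apply (φ.measurableSet_fiber _)]
    _ ≤ ∑ v : φ.range, (v : ℝ≥0∞) * (k v * t + t) := by gcongr with v; exact hk v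
    _ = ((∑ i : Σ v, Fin (k v), (i.1 : ℝ≥0)) * t + (∑ v ∈ φ.range, v) * t : ℝ≥0) := by
        rw [Fintype.sum_sigma, ← Finset.sum_coe_sort φ.range, ← add_mul, ← Finset.sum_add_distrib,
          Finset.sum_mul]
        push_cast
        refine Finset.sum_congr rfl fun v _ => ?_
        simp only [Finset.sum_const, Finset.card_univ, Fintype.card_fin, nsmul_eq_mul]
        ring
    _ ≤ (∑ i : Σ v, Fin (k v), (i.1 : ℝ≥0) : ℝ≥0) * t + δ := by
        rw [ENNReal.coe_add, ENNReal.coe_mul]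
        gcongr

namespace IsRearrangementInvariantSpace

theorem mul_posNorm_indicator_le_of_lt_lintegral (hX : IsRearrangementInvariantSpace μ N)
    {A : Set P} (hA : MeasurableSet A) (hAfin : μ A < ∞) {g : P → ℝ≥0∞} (hg : AEMeasurable g μ)
    {c : ℝ≥0∞} (h : c < ∫⁻ x in A, g x ∂μ) :
    c * posNorm N (A.indicator 1) ≤ 2 * μ A * posNorm N g := by
  obtain ⟨ι, _, R, a, t, hRm, hRd, hRA, hRt, hag, hct⟩ :=
    exists_equimeasurable_minorant_of_lt_lintegral hA hAfin h
  set U := ⋃ i, R i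
  have hUm : MeasurableSet U := MeasurableSet.iUnion hRm
  have hUA : μ U ≤ μ A := measure_mono (iUnion_subset hRA)
  have hUμ : μ U = Fintype.card ι * t := by
    rw [measure_iUnion hRd hRm, tsum_fintype]
    simp [hRt]
  have hU0 : μ U ≠ 0 := by
    intro h0
    rw [hUμ, mul_eq_zero, Nat.cast_eq_zero, Fintype.card_eq_zero_iff] at h0
    rcases h0 with hι | ht
    · simp at hct
    · simp [ht] at hct
  have haverage : (∑ i, a i : ℝ≥0) * posNorm N (U.indicator 1) ≤ Fintype.card ι * posNorm N g :=
    (sum_mul_posNorm_indicator_iUnion_le hX hRm hRd hRt a).trans <| mul_le_mul_right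
      (hX.posNorm_mono (measurable_stepFun hRm _).aemeasurable hg
        (Eventually.of_forall (stepFun_le hRd hag))) _
  refine (ENNReal.mul_le_mul_iff_right hU0 (hUA.trans_lt hAfin).ne).1 ?_
  calc μ U * (c * posNorm N (A.indicator 1))
      = c * (μ U * posNorm N (A.indicator 1)) := by ring
    _ ≤ (∑ i, a i : ℝ≥0) * t * (2 * μ A * posNorm N (U.indicator 1)) :=
        mul_le_mul' hct.le (hX.measure_mul_posNorm_indicator_le hUm hA hAfin hUA)
    _ = 2 * μ A * t * ((∑ i, a i : ℝ≥0) * posNorm N (U.indicator 1)) := by ring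
    _ ≤ 2 * μ A * t * (Fintype.card ι * posNorm N g) := by gcongr
    _ = μ U * (2 * μ A * posNorm N g) := by rw [hUμ]; ring

theorem mul_posNorm_indicator_le_of_mul_measure_le (hX : IsRearrangementInvariantSpace μ N)
    {A : Set P} (hA : MeasurableSet A) (hAfin : μ A < ∞) {g : P → ℝ≥0∞} (hg : AEMeasurable g μ)
    {σ : ℝ≥0∞} (h : σ * μ A ≤ ∫⁻ x in A, g x ∂μ) :
    σ * posNorm N (A.indicator 1) ≤ 2 * posNorm N g := by
  rcases eq_or_ne (μ A) 0 with hA0 | hA0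
  · have hnull := hX.posNorm_indicator_le_of_measure_le_mul hA hAfin 0 hA (by simp [hA0])
    rw [Nat.cast_zero, zero_mul, nonpos_iff_eq_zero] at hnull
    simp [hnull]
  have hintegral : (∫⁻ x in A, g x ∂μ) * posNorm N (A.indicator 1) ≤ 2 * μ A * posNorm N g :=
    ENNReal.mul_le_of_forall_lt fun c hc b hb =>
      (mul_le_mul_right hb.le c).trans (hX.mul_posNorm_indicator_le_of_lt_lintegral hA hAfin hg hc)
  refine (ENNReal.mul_le_mul_iff_right hA0 hAfin.ne).1 ?_
  calc μ A * (σ * posNorm N (A.indicator 1))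
      = σ * μ A * posNorm N (A.indicator 1) := by ring
    _ ≤ (∫⁻ x in A, g x ∂μ) * posNorm N (A.indicator 1) := by gcongr
    _ ≤ 2 * μ A * posNorm N g := hintegral
    _ = μ A * (2 * posNorm N g) := by ring

end IsRearrangementInvariantSpace

end Averaging

section Doubling

variable {P : Type*} [PseudoMetricSpace P] [MeasurableSpace P] {μ : Measure P} {C : ℝ≥0}

/-- `μ` is doubling with constant `C`. The radius ranges over all of `ℝ`; balls of nonpositive
radius are empty. -/
def IsDoublingWith (C : ℝ≥0) (μ : Measure P) : Prop :=
  ∀ (x : P) (r : ℝ), μ (Metric.ball x (2 * r)) ≤ C * μ (Metric.ball x r)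

theorem IsDoubling.exists_isDoublingWith {P : Type*} [MetricSpace P] [MeasurableSpace P]
    {μ : Measure P} (h : IsDoubling μ) : ∃ C : ℝ≥0, IsDoublingWith C μ := by
  obtain ⟨C, -, hC⟩ := h
  refine ⟨C, fun x r => ?_⟩
  rcases le_or_gt r 0 with hr | hr
  · simp [Metric.ball_eq_empty.2 (by linarith : 2 * r ≤ 0)]
  · exact hC x r hr

namespace IsDoublingWith

theorem measure_ball_two_pow_mul_le (hC : IsDoublingWith C μ) (n : ℕ) (x : P) (r : ℝ) :
    μ (Metric.ball x (2 ^ n * r)) ≤ C ^ n * μ (Metric.ball x r) := by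
  induction n with
  | zero => simp
  | succ n ih =>
    rw [pow_succ', mul_assoc, pow_succ', mul_assoc]
    exact (hC x _).trans (by gcongr)

theorem measure_ball_lt_top [IsLocallyFiniteMeasure μ] (hC : IsDoublingWith C μ) (x : P) (r : ℝ) :
    μ (Metric.ball x r) < ∞ := by
  obtain ⟨U, hU, hUfin⟩ := μ.finiteAt_nhds x
  obtain ⟨s, hs, hsU⟩ := Metric.mem_nhds_iff.1 hU
  obtain ⟨n, hn⟩ := pow_unbounded_of_one_lt (r / s) one_lt_two
  rw [div_lt_iff₀ hs] at hn
  calc μ (Metric.ball x r) ≤ μ (Metric.ball x (2 ^ n * s)) :=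
        measure_mono (Metric.ball_subset_ball hn.le)
    _ ≤ C ^ n * μ (Metric.ball x s) := hC.measure_ball_two_pow_mul_le n x s
    _ < ∞ := ENNReal.mul_lt_top (ENNReal.pow_lt_top ENNReal.coe_lt_top)
        ((measure_mono hsU).trans_lt hUfin)

theorem isUnifLocDoublingMeasure (hC : IsDoublingWith C μ) : IsUnifLocDoublingMeasure μ := by
  refine ⟨C ^ 2, ?_⟩
  filter_upwards [self_mem_nhdsWithin] with r (hr : 0 < r) x
  calc μ (Metric.closedBall x (2 * r)) ≤ μ (Metric.ball x (2 ^ 2 * r)) :=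
        measure_mono (Metric.closedBall_subset_ball (by linarith))
    _ ≤ C ^ 2 * μ (Metric.ball x r) := hC.measure_ball_two_pow_mul_le 2 x r
    _ ≤ (C ^ 2 : ℝ≥0) * μ (Metric.closedBall x r) := by
        push_cast
        gcongr
        exact Metric.ball_subset_closedBall

theorem integrableOn_ball_of_abs_le [IsLocallyFiniteMeasure μ] (hC : IsDoublingWith C μ)
    {v : P → ℝ} (hv : AEMeasurable v μ) {k : ℝ} (hk : ∀ x, |v x| ≤ k) (x : P) (r : ℝ) :
    IntegrableOn v (Metric.ball x r) μ :=
  Measure.integrableOn_of_bounded (hC.measure_ball_lt_top x r).ne hv.aestronglyMeasurable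
    (Eventually.of_forall hk)

end IsDoublingWith

end Doubling

section MaximalFunction

variable {P : Type*} [MeasurableSpace P]

/-- The Hardy–Littlewood maximal function over balls centred at `x` of radius at most `R`. -/
noncomputable def maximalFunction [PseudoMetricSpace P] (μ : Measure P) (R : ℝ) (g : P → ℝ≥0∞)
    (x : P) : ℝ≥0∞ :=
  ⨆ s ∈ Ioc 0 R, ⨍⁻ y in Metric.ball x s, g y ∂μ

theorem maximalFunction_le_add_of_le_add [PseudoMetricSpace P] {μ : Measure P} {R : ℝ}
    {f g : P → ℝ≥0∞} {c : ℝ≥0∞} (h : ∀ x, f x ≤ g x + c) (x : P) :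
    maximalFunction μ R f x ≤ maximalFunction μ R g x + c := by
  refine iSup₂_le fun s hs => ?_
  calc ⨍⁻ y in Metric.ball x s, f y ∂μ
      ≤ ⨍⁻ y in Metric.ball x s, (g y + c) ∂μ :=
        setLAverage_mono_ae _ (Eventually.of_forall h)
    _ = ⨍⁻ y in Metric.ball x s, g y ∂μ + ⨍⁻ _ in Metric.ball x s, c ∂μ :=
        lintegral_add_right _ measurable_const
    _ ≤ maximalFunction μ R g x + c := by
        refine add_le_add (le_iSup₂_of_le s hs le_rfl) ?_
        exact (setLAverage_le_essSup _ _).trans (essSup_le_of_ae_le _ (ae_of_all _ fun _ => le_rfl))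

theorem measure_lt_top_and_mul_le_lintegral_of_lt_setLAverage {μ : Measure P} {g : P → ℝ≥0∞}
    {B : Set P} {σ : ℝ≥0∞} (h : σ < ⨍⁻ x in B, g x ∂μ) :
    μ B < ∞ ∧ σ * μ B ≤ ∫⁻ x in B, g x ∂μ := by
  rw [setLAverage_eq] at h
  refine ⟨lt_top_iff_ne_top.2 fun htop => ?_, ENNReal.mul_le_of_le_div h.le⟩
  simp [htop] at h

theorem IsBanachFunctionSpace.posNorm_indicator_iUnion_le_of_finset {μ : Measure P}
    {N : (P → EReal) → ℝ≥0∞} (hX : IsBanachFunctionSpace μ N) {ι : Type*} [Countable ι]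
    {E : ι → Set P} (hE : ∀ i, MeasurableSet (E i)) {c : ℝ≥0∞}
    (h : ∀ F : Finset ι, posNorm N ((⋃ i ∈ F, E i).indicator 1) ≤ c) :
    posNorm N ((⋃ i, E i).indicator 1) ≤ c := by
  classical
  rcases isEmpty_or_nonempty ι with hι | hι
  · simpa using h ∅
  obtain ⟨e, he⟩ := exists_surjective_nat ι
  have hset : ⋃ i, E i = ⋃ n, ⋃ i ∈ (Finset.range n).image e, E i := by
    rw [← he.iUnion_comp]
    ext x
    simp only [mem_iUnion, Finset.mem_image, Finset.mem_range, exists_prop]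
    exact ⟨fun ⟨n, hx⟩ => ⟨n + 1, _, ⟨n, n.lt_succ_self, rfl⟩, hx⟩,
      fun ⟨_, _, ⟨i, _, hi⟩, hx⟩ => ⟨i, hi ▸ hx⟩⟩
  rw [hset]
  exact hX.posNorm_indicator_iUnion_le (fun n => Finset.measurableSet_biUnion _ fun i _ => hE i)
    (fun m n hmn => biUnion_subset_biUnion_left (Finset.image_subset_image (Finset.range_mono hmn)))
    fun n => h _

section CountablySeparated

variable {μ : Measure P} {N : (P → EReal) → ℝ≥0∞} [MeasurableSpace.CountablySeparated P]
  [NullSingletonClass μ]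

theorem IsRearrangementInvariantSpace.mul_posNorm_indicator_biUnion_le
    (hX : IsRearrangementInvariantSpace μ N) {g : P → ℝ≥0∞} (hg : AEMeasurable g μ) {σ : ℝ≥0∞}
    {ι : Type*} {B E : ι → Set P} (F : Finset ι) (hB : ∀ i, MeasurableSet (B i))
    (hE : ∀ i, MeasurableSet (E i)) (hd : Pairwise (Function.onFun Disjoint B))
    (hfin : ∀ i, μ (B i) < ∞) {m : ℕ} (hm : ∀ i, μ (E i) ≤ m * μ (B i))
    (hσ : ∀ i, σ * μ (B i) ≤ ∫⁻ x in B i, g x ∂μ) :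
    σ * posNorm N ((⋃ i ∈ F, E i).indicator 1) ≤ m * (2 * posNorm N g) := by
  have hd' : (F : Set ι).PairwiseDisjoint B := fun i _ j _ hij => hd hij
  set A := ⋃ i ∈ F, B i
  have hA : MeasurableSet A := F.measurableSet_biUnion fun i _ => hB i
  have hAμ : μ A = ∑ i ∈ F, μ (B i) := measure_biUnion_finset hd' fun i _ => hB i
  have hAfin : μ A < ∞ := by
    rw [hAμ, ENNReal.sum_lt_top]
    exact fun i _ => hfin i
  have hEA : μ (⋃ i ∈ F, E i) ≤ m * μ A := by
    refine (measure_biUnion_finset_le F E).trans ?_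
    rw [hAμ, Finset.mul_sum]
    exact Finset.sum_le_sum fun i _ => hm i
  have hσA : σ * μ A ≤ ∫⁻ x in A, g x ∂μ := by
    rw [lintegral_biUnion_finset hd' fun i _ => hB i, hAμ, Finset.mul_sum]
    exact Finset.sum_le_sum fun i _ => hσ i
  calc σ * posNorm N ((⋃ i ∈ F, E i).indicator 1)
      ≤ σ * (m * posNorm N (A.indicator 1)) := by
        gcongr
        exact hX.posNorm_indicator_le_of_measure_le_mul hA hAfin m
          (F.measurableSet_biUnion fun i _ => hE i) hEA
    _ = m * (σ * posNorm N (A.indicator 1)) := by ring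
    _ ≤ m * (2 * posNorm N g) :=
        mul_le_mul_right (hX.mul_posNorm_indicator_le_of_mul_measure_le hA hAfin hg hσA) _

theorem IsRearrangementInvariantSpace.mul_posNorm_indicator_iUnion_le
    (hX : IsRearrangementInvariantSpace μ N) {g : P → ℝ≥0∞} (hg : AEMeasurable g μ) {σ : ℝ≥0}
    {ι : Type*} [Countable ι] {B E : ι → Set P} (hB : ∀ i, MeasurableSet (B i))
    (hE : ∀ i, MeasurableSet (E i)) (hd : Pairwise (Function.onFun Disjoint B))
    (hfin : ∀ i, μ (B i) < ∞) {m : ℕ} (hm : ∀ i, μ (E i) ≤ m * μ (B i))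
    (hσ : ∀ i, σ * μ (B i) ≤ ∫⁻ x in B i, g x ∂μ) :
    σ * posNorm N ((⋃ i, E i).indicator 1) ≤ m * (2 * posNorm N g) := by
  rcases eq_or_ne σ 0 with rfl | hσ0
  · simp
  have hdiv : ∀ y z : ℝ≥0∞, y ≤ z / σ ↔ σ * y ≤ z := fun y z => by
    rw [ENNReal.le_div_iff_mul_le (.inl (by simpa using hσ0)) (.inl ENNReal.coe_ne_top), mul_comm]
  rw [← hdiv]
  exact hX.posNorm_indicator_iUnion_le_of_finset hE fun F =>
    (hdiv _ _).2 (hX.mul_posNorm_indicator_biUnion_le hg F hB hE hd hfin hm hσ)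

end CountablySeparated

theorem IsRearrangementInvariantSpace.exists_isOpen_superset_lt_maximalFunction
    [MetricSpace P] [SecondCountableTopology P] [OpensMeasurableSpace P] {μ : Measure P}
    [NullSingletonClass μ] {N : (P → EReal) → ℝ≥0∞} (hX : IsRearrangementInvariantSpace μ N)
    {C : ℝ≥0} (hC : IsDoublingWith C μ) {g : P → ℝ≥0∞} (hg : AEMeasurable g μ) (R : ℝ) (σ : ℝ≥0) :
    ∃ E : Set P, IsOpen E ∧ {x | σ < maximalFunction μ R g x} ⊆ E ∧
      σ * posNorm N (E.indicator 1) ≤ ⌈C ^ 3⌉₊ * (2 * posNorm N g) := by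
  set T := {x | σ < maximalFunction μ R g x}
  have hradius : ∀ x ∈ T, ∃ s ∈ Ioc 0 R, σ < ⨍⁻ y in Metric.ball x s, g y ∂μ := fun x hx => by
    simpa only [T, mem_ofPred_eq, maximalFunction, lt_iSup_iff, exists_prop] using hx
  choose! r hr using hradius
  obtain ⟨U, hUT, hUd, hUcover⟩ :=
    Vitali.exists_disjoint_subfamily_covering_enlargement_closedBall T id r R
      (fun x hx => (hr x hx).1.2) 5 (by norm_num)
  have hd : U.PairwiseDisjoint fun a => Metric.ball a (r a) := fun a ha b hb hab =>
    (hUd ha hb hab).mono Metric.ball_subset_closedBall Metric.ball_subset_closedBall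
  have hpos : ∀ a : U, 0 < r a := fun a => (hr a (hUT a.2)).1.1
  have : Countable U := (hd.countable_of_isOpen (fun _ _ => Metric.isOpen_ball)
    fun a ha => ⟨a, Metric.mem_ball_self (hpos ⟨a, ha⟩)⟩).to_subtype
  have hB : ∀ a : U, _ := fun a =>
    measure_lt_top_and_mul_le_lintegral_of_lt_setLAverage (hr a (hUT a.2)).2
  refine ⟨⋃ a : U, Metric.ball a (2 ^ 3 * r a), isOpen_iUnion fun _ => Metric.isOpen_ball,
    fun x hx => ?_, hX.mul_posNorm_indicator_iUnion_le hg
      (B := fun a : U => Metric.ball a (r a)) (fun _ => measurableSet_ball)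
      (fun _ => measurableSet_ball) (fun a b hab => hd a.2 b.2 (Subtype.coe_injective.ne hab))
      (fun a => (hB a).1) (fun a => ?_) fun a => (hB a).2⟩
  · obtain ⟨b, hb, hsub⟩ := hUcover x hx
    exact mem_iUnion.2 ⟨⟨b, hb⟩, Metric.closedBall_subset_ball
      (by linarith [hpos ⟨b, hb⟩]) (hsub (Metric.mem_closedBall_self (hr x hx).1.1.le))⟩
  · refine (hC.measure_ball_two_pow_mul_le 3 a (r a)).trans ?_
    have hceil : ((C ^ 3 : ℝ≥0) : ℝ≥0∞) ≤ (⌈C ^ 3⌉₊ : ℝ≥0) := ENNReal.coe_le_coe.2 (Nat.le_ceil _)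
    rw [ENNReal.coe_pow, ENNReal.coe_natCast] at hceil
    gcongr

end MaximalFunction

section Oscillation

variable {P : Type*} [MeasurableSpace P] {μ : Measure P}

theorem edist_setAverage_le {V : Type*} [NormedAddCommGroup V] [NormedSpace ℝ V] [CompleteSpace V]
    {S B : Set P} (hSB : S ⊆ B) (hS0 : μ S ≠ 0) (hBfin : μ B ≠ ∞) {v : P → V}
    (hv : IntegrableOn v B μ) (m : V) {D : ℝ≥0∞} (hD : μ B ≤ D * μ S) :
    edist (⨍ x in S, v x ∂μ) m ≤ D * ⨍⁻ x in B, edist (v x) m ∂μ := by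
  have hSfin : μ S ≠ ∞ := ((measure_mono hSB).trans_lt hBfin.lt_top).ne
  have : IsFiniteMeasure (μ.restrict S) := ⟨by simpa using hSfin.lt_top⟩
  have : NeZero (μ.restrict S) := ⟨by simpa using hS0⟩
  have hsub : (⨍ x in S, v x ∂μ) - m = ⨍ x in S, (v x - m) ∂μ := by
    conv_lhs => rw [← average_const (μ.restrict S) m]
    exact (integral_sub (hv.mono_set hSB).to_average (integrable_const _)).symm
  rw [edist_eq_enorm_sub, hsub]
  calc ‖⨍ x in S, (v x - m) ∂μ‖ₑ ≤ ⨍⁻ x in S, ‖v x - m‖ₑ ∂μ :=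
        enorm_integral_le_lintegral_enorm _
    _ = (∫⁻ x in S, edist (v x) m ∂μ) / μ S := by simp only [setLAverage_eq, edist_eq_enorm_sub]
    _ ≤ (∫⁻ x in B, edist (v x) m ∂μ) / μ S := by gcongr
    _ = μ B * (⨍⁻ x in B, edist (v x) m ∂μ) / μ S := by rw [measure_mul_setLAverage _ hBfin]
    _ ≤ D * μ S * (⨍⁻ x in B, edist (v x) m ∂μ) / μ S := by gcongr
    _ = D * ⨍⁻ x in B, edist (v x) m ∂μ := by
        rw [mul_right_comm, ENNReal.mul_div_cancel_right hS0 hSfin]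

/-- The mean oscillation of `v` over the ball `B(x, r)`. -/
noncomputable def meanOscillation [PseudoMetricSpace P] (μ : Measure P) (v : P → ℝ) (x : P)
    (r : ℝ) : ℝ≥0∞ :=
  ⨍⁻ y in Metric.ball x r, edist (v y) (⨍ z in Metric.ball x r, v z ∂μ) ∂μ

/-- The averages of `v` over balls centred at `x` tend to `v x`. -/
def IsWeakLebesguePoint [PseudoMetricSpace P] (μ : Measure P) (v : P → ℝ) (x : P) : Prop :=
  Tendsto (fun s => ⨍ y in Metric.closedBall x s, v y ∂μ) (𝓝[>] 0) (𝓝 (v x))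

theorem IsDoublingWith.ae_isWeakLebesguePoint {P : Type*} [MetricSpace P] [MeasurableSpace P]
    [BorelSpace P] [SecondCountableTopology P] {μ : Measure P} [IsLocallyFiniteMeasure μ]
    {C : ℝ≥0} (hC : IsDoublingWith C μ) {v : P → ℝ} (hv : LocallyIntegrable v μ) :
    ∀ᵐ x ∂μ, IsWeakLebesguePoint μ v x := by
  have := hC.isUnifLocDoublingMeasure
  filter_upwards [IsUnifLocDoublingMeasure.ae_tendsto_average μ hv 1] with x hx
  refine hx (fun _ => x) id tendsto_id ?_
  filter_upwards [self_mem_nhdsWithin] with s (hs : 0 < s)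
  simpa using hs.le

variable [PseudoMetricSpace P] [IsLocallyFiniteMeasure μ] [μ.IsOpenPosMeasure] {C : ℝ≥0} {v : P → ℝ}

theorem edist_setAverage_closedBall_le_meanOscillation (hC : IsDoublingWith C μ)
    (hv : ∀ x r, IntegrableOn v (Metric.ball x r) μ) (n : ℕ) {x z : P} {s ρ : ℝ} (hs : 0 < s)
    (hsub : Metric.closedBall z s ⊆ Metric.ball x ρ)
    (hsub' : Metric.ball x ρ ⊆ Metric.ball z (2 ^ n * s)) :
    edist (⨍ y in Metric.closedBall z s, v y ∂μ) (⨍ y in Metric.ball x ρ, v y ∂μ) ≤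
      C ^ n * meanOscillation μ v x ρ := by
  refine edist_setAverage_le hsub (Metric.measure_closedBall_pos μ z hs).ne'
    (hC.measure_ball_lt_top x ρ).ne (hv x ρ) _ ?_
  calc μ (Metric.ball x ρ) ≤ μ (Metric.ball z (2 ^ n * s)) := measure_mono hsub'
    _ ≤ C ^ n * μ (Metric.ball z s) := hC.measure_ball_two_pow_mul_le n z s
    _ ≤ C ^ n * μ (Metric.closedBall z s) := by gcongr; exact Metric.ball_subset_closedBall

theorem IsWeakLebesguePoint.edist_setAverage_closedBall_le {x : P}
    (hx : IsWeakLebesguePoint μ v x) (hC : IsDoublingWith C μ)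
    (hv : ∀ x r, IntegrableOn v (Metric.ball x r) μ) {M : ℝ≥0∞} {r : ℝ} (hr : 0 < r)
    (hosc : ∀ ρ ∈ Ioc 0 (2 * r), meanOscillation μ v x ρ ≤ M * ENNReal.ofReal ρ) :
    edist (⨍ y in Metric.closedBall x r, v y ∂μ) (v x) ≤
      4 * (C + C ^ 2) * M * ENNReal.ofReal r := by
  set a : ℕ → ℝ := fun j => ⨍ y in Metric.closedBall x (r / 2 ^ j), v y ∂μ with ha
  have hpos : ∀ j : ℕ, 0 < r / 2 ^ j := fun j => by positivity
  have hstep : ∀ j, edist (a j) (a (j + 1)) ≤ 2 * (C + C ^ 2) * M * ENNReal.ofReal r / 2 ^ j := by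
    intro j
    have hj := hpos j
    have hhalf : 2 ^ 2 * (r / 2 ^ (j + 1)) = 2 * (r / 2 ^ j) := by ring
    have hle : r / 2 ^ j ≤ r := div_le_self hr.le (one_le_pow₀ one_le_two)
    set ρ := 2 * (r / 2 ^ j) with hρ
    have hj_le := edist_setAverage_closedBall_le_meanOscillation hC hv 1 (x := x) hj
      (Metric.closedBall_subset_ball (by linarith : r / 2 ^ j < ρ)) (by rw [pow_one])
    have hsucc_le := edist_setAverage_closedBall_le_meanOscillation hC hv 2 (x := x)
      (hpos (j + 1))
      (Metric.closedBall_subset_ball (by linarith : r / 2 ^ (j + 1) < ρ)) (by rw [hhalf])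
    calc edist (a j) (a (j + 1))
        ≤ C ^ 1 * meanOscillation μ v x ρ + C ^ 2 * meanOscillation μ v x ρ :=
          (edist_triangle_right _ _ _).trans (add_le_add hj_le hsucc_le)
      _ ≤ C ^ 1 * (M * ENNReal.ofReal ρ) + C ^ 2 * (M * ENNReal.ofReal ρ) := by
          have := hosc ρ ⟨by positivity, by linarith⟩
          gcongr
      _ = 2 * (C + C ^ 2) * M * ENNReal.ofReal r / 2 ^ j := by
          rw [hρ, ENNReal.ofReal_mul zero_le_two, ENNReal.ofReal_div_of_pos (by positivity),
            ENNReal.ofReal_pow zero_le_two, ENNReal.ofReal_ofNat]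
          simp only [div_eq_mul_inv]
          ring
  have hlim : Tendsto a atTop (𝓝 (v x)) :=
    hx.comp (tendsto_nhdsWithin_iff.2 ⟨tendsto_const_nhds.div_atTop
      (tendsto_pow_atTop_atTop_of_one_lt one_lt_two), Eventually.of_forall hpos⟩)
  calc edist (⨍ y in Metric.closedBall x r, v y ∂μ) (v x) = edist (a 0) (v x) := by simp [ha]
    _ ≤ 2 * (2 * (C + C ^ 2) * M * ENNReal.ofReal r) :=
        edist_le_of_edist_le_geometric_two_of_tendsto₀ _ hstep hlim
    _ = 4 * (C + C ^ 2) * M * ENNReal.ofReal r := by ring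

theorem edist_le_of_meanOscillation_le (hC : IsDoublingWith C μ)
    (hv : ∀ x r, IntegrableOn v (Metric.ball x r) μ) {M : ℝ≥0∞} {x y : P} {R : ℝ}
    (hxy : 4 * dist x y ≤ R) (hx : IsWeakLebesguePoint μ v x) (hy : IsWeakLebesguePoint μ v y)
    (hoscx : ∀ ρ ∈ Ioc 0 R, meanOscillation μ v x ρ ≤ M * ENNReal.ofReal ρ)
    (hoscy : ∀ ρ ∈ Ioc 0 R, meanOscillation μ v y ρ ≤ M * ENNReal.ofReal ρ) (hpos : 0 < dist x y) :
    edist (v x) (v y) ≤ (8 * C + 12 * C ^ 2 + 4 * C ^ 3) * M * edist x y := by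
  rw [edist_dist x y]
  set r := dist x y
  set A := ⨍ z in Metric.closedBall x r, v z ∂μ
  set B := ⨍ z in Metric.closedBall y r, v z ∂μ
  set m := ⨍ z in Metric.ball x (4 * r), v z ∂μ
  have hosc : meanOscillation μ v x (4 * r) ≤ M * (4 * ENNReal.ofReal r) := by
    refine (hoscx _ ⟨by positivity, hxy⟩).trans_eq ?_
    rw [ENNReal.ofReal_mul (by norm_num), ENNReal.ofReal_ofNat]
  have hxA : edist A (v x) ≤ 4 * (C + C ^ 2) * M * ENNReal.ofReal r :=
    hx.edist_setAverage_closedBall_le hC hv hpos fun ρ hρ => hoscx ρ ⟨hρ.1, by linarith [hρ.2]⟩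
  have hyB : edist B (v y) ≤ 4 * (C + C ^ 2) * M * ENNReal.ofReal r :=
    hy.edist_setAverage_closedBall_le hC hv hpos fun ρ hρ => hoscy ρ ⟨hρ.1, by linarith [hρ.2]⟩
  have hAm : edist A m ≤ C ^ 2 * (M * (4 * ENNReal.ofReal r)) :=
    (edist_setAverage_closedBall_le_meanOscillation hC hv 2 hpos
      (Metric.closedBall_subset_ball (by linarith)) (Metric.ball_subset_ball (by linarith))).trans
      (by gcongr)
  have hBm : edist B m ≤ C ^ 3 * (M * (4 * ENNReal.ofReal r)) :=
    (edist_setAverage_closedBall_le_meanOscillation hC hv 3 hpos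
      (Metric.closedBall_subset_ball' (by rw [dist_comm y x]; linarith))
      (Metric.ball_subset_ball' (by linarith))).trans (by gcongr)
  calc edist (v x) (v y) ≤ edist A (v x) + (edist A m + edist B m + edist B (v y)) := by
        refine (edist_triangle_left _ _ A).trans (add_le_add le_rfl ?_)
        exact (edist_triangle _ B _).trans (add_le_add (edist_triangle_right _ _ _) le_rfl)
    _ ≤ 4 * (C + C ^ 2) * M * ENNReal.ofReal r + (C ^ 2 * (M * (4 * ENNReal.ofReal r)) +
          C ^ 3 * (M * (4 * ENNReal.ofReal r)) + 4 * (C + C ^ 2) * M * ENNReal.ofReal r) := by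
        gcongr
    _ = (8 * C + 12 * C ^ 2 + 4 * C ^ 3) * M * ENNReal.ofReal r := by ring

end Oscillation

section ExtendedReal

theorem ereal_abs_coe_sub_coe (a b : ℝ) : ((a : EReal) - b).abs = edist a b := by
  rw [← EReal.coe_sub, EReal.abs_def, edist_dist, Real.dist_eq]

theorem ereal_eq_coe_toReal_of_abs_sub_lt_top {a b : EReal} (h : (a - b).abs < ∞) :
    a = a.toReal ∧ b = b.toReal := by
  induction a <;> induction b <;> simp_all

theorem ereal_abs_neg_sub_neg (a b : EReal) : (-a - -b).abs = (a - b).abs := by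
  induction a <;> induction b <;> try simp
  rw [← EReal.coe_neg, ← EReal.coe_neg, ereal_abs_coe_sub_coe, ereal_abs_coe_sub_coe, edist_neg_neg]

theorem ereal_abs_add_sub_add_le (a b a' b' : EReal) :
    (a + b - (a' + b')).abs ≤ (a - a').abs + (b - b').abs := by
  rcases eq_or_ne ((a - a').abs + (b - b').abs) ∞ with htop | hfin
  · exact htop ▸ le_top
  obtain ⟨hafin, hbfin⟩ := ENNReal.add_lt_top.1 hfin.lt_top
  obtain ⟨ha, ha'⟩ := ereal_eq_coe_toReal_of_abs_sub_lt_top hafin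
  obtain ⟨hb, hb'⟩ := ereal_eq_coe_toReal_of_abs_sub_lt_top hbfin
  rw [ha, ha', hb, hb', ← EReal.coe_add, ← EReal.coe_add]
  simp only [ereal_abs_coe_sub_coe]
  exact edist_add_add_le _ _ _ _

theorem ereal_sub_add_coe_sub (a : EReal) (b c : ℝ) : a - b + (b - c : ℝ) = a - c := by
  induction a with
  | bot => simp
  | top => rw [EReal.top_sub_coe, EReal.top_add_coe, EReal.top_sub_coe]
  | coe a => norm_cast; ring

theorem aemeasurable_ereal_sub_coe {P : Type*} [MeasurableSpace P] {μ : Measure P}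
    {u : P → EReal} (hu : AEMeasurable u μ) {v : P → ℝ} (hv : AEMeasurable v μ) :
    AEMeasurable (fun x => u x - v x) μ := by
  simp only [sub_eq_add_neg, ← EReal.coe_neg]
  exact hu.add hv.neg.coe_real_ereal

end ExtendedReal

section Curves

theorem hasUnitSpeedOn_comp_const_add {P : Type*} [PseudoEMetricSpace P] {γ : ℝ → P} {l s t : ℝ}
    (hγ : HasUnitSpeedOn γ (Icc 0 l)) (hs : 0 ≤ s) (ht : t ≤ l) :
    HasUnitSpeedOn (fun τ => γ (s + τ)) (Icc 0 (t - s)) := by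
  refine hasConstantSpeedOnWith_iff_ordered.2 fun x hx y hy hxy => ?_
  have hspeed := hasConstantSpeedOnWith_iff_ordered.1 hγ (x := s + x)
    ⟨by linarith [hx.1], by linarith [hx.2]⟩ (y := s + y)
    ⟨by linarith [hy.1], by linarith [hy.2]⟩ (by linarith)
  rw [inter_eq_right.2 (Icc_subset_Icc (by linarith [hx.1]) (by linarith [hy.2]))] at hspeed
  have hcomp := eVariationOn.comp_eq_of_monotoneOn γ (fun τ => s + τ) (t := Icc x y)
    (fun a _ b _ hab => by simpa using hab)
  rw [image_const_add_Icc, hspeed, add_sub_add_left_eq_sub] at hcomp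
  rwa [inter_eq_right.2 (Icc_subset_Icc hx.1 hy.2)]

theorem edist_le_of_hasUnitSpeedOn {P : Type*} [PseudoEMetricSpace P] {γ : ℝ → P} {l : ℝ}
    (hl : 0 ≤ l) (hγ : HasUnitSpeedOn γ (Icc 0 l)) : edist (γ 0) (γ l) ≤ ENNReal.ofReal l := by
  have hlength := hasConstantSpeedOnWith_iff_ordered.1 hγ (left_mem_Icc.2 hl)
    (right_mem_Icc.2 hl) hl
  refine (eVariationOn.edist_le γ (left_mem_Icc.2 hl) (right_mem_Icc.2 hl)).trans_eq ?_
  simpa using hlength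

theorem continuousOn_of_edist_le_setLIntegral {V : Type*} [PseudoEMetricSpace V] {φ : ℝ → V}
    {F : ℝ → ℝ≥0∞} {a b : ℝ} (hF : ∫⁻ t in Icc a b, F t ≠ ∞)
    (h : ∀ s ∈ Icc a b, ∀ t ∈ Icc a b, s ≤ t → edist (φ s) (φ t) ≤ ∫⁻ τ in Icc s t, F τ) :
    ContinuousOn φ (Icc a b) := by
  intro x hx
  rw [ContinuousWithinAt, tendsto_iff_edist_tendsto_0]
  have hvol : Tendsto (fun y => volume.restrict (Icc a b) (uIcc x y)) (𝓝[Icc a b] x) (𝓝 0) := by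
    refine tendsto_of_tendsto_of_tendsto_of_le_of_le tendsto_const_nhds ?_ (fun _ => zero_le)
      (fun y => Measure.restrict_apply_le _ _)
    simp only [Real.volume_interval]
    have hcont : Continuous fun y => ENNReal.ofReal |y - x| :=
      ENNReal.continuous_ofReal.comp (by fun_prop)
    simpa using (hcont.tendsto x).mono_left nhdsWithin_le_nhds
  refine tendsto_of_tendsto_of_tendsto_of_le_of_le' tendsto_const_nhds
    (tendsto_setLIntegral_zero hF hvol) (Eventually.of_forall fun _ => zero_le) ?_
  filter_upwards [self_mem_nhdsWithin] with y hy
  rw [Measure.restrict_restrict_of_subset (uIcc_subset_Icc hx hy)]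
  rcases le_total x y with hxy | hxy
  · rw [uIcc_of_le hxy, edist_comm]
    exact h x hx y hy hxy
  · rw [uIcc_of_ge hxy]
    exact h y hy x hx hxy

-- Only the parts of `[a, b]` before the first and after the last visit to `p` contribute.
theorem edist_le_setLIntegral_of_forall_ne {V : Type*} [EMetricSpace V] {φ : ℝ → V}
    {F G : ℝ → ℝ≥0∞} {a b : ℝ} (hab : a ≤ b) (hcont : ContinuousOn φ (Icc a b))
    (h : ∀ s ∈ Icc a b, ∀ t ∈ Icc a b, s ≤ t → edist (φ s) (φ t) ≤ ∫⁻ τ in Icc s t, F τ)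
    (p : V) (hFG : ∀ t ∈ Icc a b, φ t ≠ p → F t ≤ G t) :
    edist (φ a) (φ b) ≤ ∫⁻ t in Icc a b, G t := by
  have ha := left_mem_Icc.2 hab
  have hb := right_mem_Icc.2 hab
  rcases (Icc a b ∩ φ ⁻¹' {p}).eq_empty_or_nonempty with hK | hK
  · refine (h a ha b hb hab).trans (setLIntegral_mono' measurableSet_Icc fun t ht => ?_)
    exact hFG t ht fun htp => (hK.subset ⟨ht, htp⟩ : t ∈ (∅ : Set ℝ))
  have hKc : IsCompact (Icc a b ∩ φ ⁻¹' {p}) :=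
    isCompact_Icc.of_isClosed_subset
      (hcont.preimage_isClosed_of_isClosed isClosed_Icc isClosed_singleton) inter_subset_left
  obtain ⟨s, hs, hs_min⟩ := hKc.exists_isLeast hK
  obtain ⟨t, ht, ht_max⟩ := hKc.exists_isGreatest hK
  have hst : φ s = φ t := (show φ s = p from hs.2).trans (show φ t = p from ht.2).symm
  have hleft : Ico a s ⊆ Icc a b := fun τ hτ => ⟨hτ.1, hτ.2.le.trans hs.1.2⟩
  have hright : Ioc t b ⊆ Icc a b := fun τ hτ => ⟨ht.1.1.trans hτ.1.le, hτ.2⟩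
  calc edist (φ a) (φ b) ≤ edist (φ a) (φ s) + edist (φ t) (φ b) := hst ▸ edist_triangle _ _ _
    _ ≤ (∫⁻ τ in Icc a s, F τ) + ∫⁻ τ in Icc t b, F τ :=
        add_le_add (h a ha s hs.1 hs.1.1) (h t ht.1 b hb ht.1.2)
    _ = (∫⁻ τ in Ico a s, F τ) + ∫⁻ τ in Ioc t b, F τ := by
        rw [setLIntegral_congr Ico_ae_eq_Icc, setLIntegral_congr Ioc_ae_eq_Icc]
    _ ≤ (∫⁻ τ in Ico a s, G τ) + ∫⁻ τ in Ioc t b, G τ :=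
        add_le_add
          (setLIntegral_mono' measurableSet_Ico fun τ hτ => hFG τ (hleft hτ) fun hp =>
            hτ.2.not_ge (hs_min ⟨hleft hτ, hp⟩))
          (setLIntegral_mono' measurableSet_Ioc fun τ hτ => hFG τ (hright hτ) fun hp =>
            hτ.1.not_ge (ht_max ⟨hright hτ, hp⟩))
    _ = ∫⁻ τ in Ico a s ∪ Ioc t b, G τ := by
        rw [lintegral_union measurableSet_Ioc]
        exact Set.disjoint_left.2 fun τ hτ hτ' => (hτ.2.trans_le (hs_min ht)).not_gt hτ'.1
    _ ≤ ∫⁻ τ in Icc a b, G τ := lintegral_mono_set (union_subset hleft hright)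

end Curves

namespace IsUpperGradient

variable {P : Type*} [MetricSpace P] {u w : P → EReal} {g g' : P → ℝ≥0∞}

theorem measurable [MeasurableSpace P] [BorelSpace P] (h : IsUpperGradient u g) :
    Measurable g := by
  rw [BorelSpace.measurable_eq (α := P)]
  exact h.1

theorem of_abs_sub_le (h : IsUpperGradient u g)
    (hw : ∀ x y, (w x - w y).abs ≤ (u x - u y).abs) : IsUpperGradient w g :=
  ⟨h.1, fun l γ hl hγ => (hw _ _).trans (h.2 l γ hl hγ)⟩

theorem add (hu : IsUpperGradient u g) (hw : IsUpperGradient w g') :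
    IsUpperGradient (fun x => u x + w x) fun x => g x + g' x :=
  ⟨hu.1.add hw.1, fun l γ hl hγ => (ereal_abs_add_sub_add_le _ _ _ _).trans
    ((add_le_add (hu.2 l γ hl hγ) (hw.2 l γ hl hγ)).trans (le_lintegral_add _ _))⟩

theorem of_lipschitzWith {f : P → ℝ} {L : ℝ≥0} (hf : LipschitzWith L f) :
    IsUpperGradient (fun x => (f x : EReal)) fun _ => L := by
  refine ⟨measurable_const, fun l γ hl hγ => ?_⟩
  rw [ereal_abs_coe_sub_coe, setLIntegral_const, Real.volume_Icc, sub_zero]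
  exact (hf _ _).trans (by gcongr; exact edist_le_of_hasUnitSpeedOn hl.le hγ)

theorem abs_sub_le (h : IsUpperGradient u g) {γ : ℝ → P} {l s t : ℝ}
    (hγ : HasUnitSpeedOn γ (Icc 0 l)) (hs : 0 ≤ s) (hst : s < t) (ht : t ≤ l) :
    (u (γ s) - u (γ t)).abs ≤ ∫⁻ τ in Icc s t, g (γ τ) := by
  have hsub := h.2 (t - s) (fun τ => γ (s + τ)) (by linarith)
    (hasUnitSpeedOn_comp_const_add hγ hs ht)
  have hshift := (measurePreserving_add_left volume s).setLIntegral_comp_preimage_emb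
    (measurableEmbedding_addLeft s) (fun τ => g (γ τ)) (Icc s t)
  rw [preimage_const_add_Icc, sub_self] at hshift
  simpa only [add_zero, add_sub_cancel, hshift] using hsub

theorem eq_coe_toReal (h : IsUpperGradient u g) {γ : ℝ → P} {l : ℝ} (hl : 0 < l)
    (hγ : HasUnitSpeedOn γ (Icc 0 l)) (hfin : ∫⁻ τ in Icc 0 l, g (γ τ) ≠ ∞) {t : ℝ}
    (ht : t ∈ Icc 0 l) : u (γ t) = (u (γ t)).toReal := by
  rcases ht.2.eq_or_lt with rfl | htl
  · exact (ereal_eq_coe_toReal_of_abs_sub_lt_top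
      ((h.abs_sub_le hγ le_rfl hl le_rfl).trans_lt hfin.lt_top)).2
  · exact (ereal_eq_coe_toReal_of_abs_sub_lt_top ((h.abs_sub_le hγ ht.1 htl le_rfl).trans_lt
      ((lintegral_mono_set (Icc_subset_Icc_left ht.1)).trans_lt hfin.lt_top))).1

theorem edist_toReal_le (h : IsUpperGradient u g) {γ : ℝ → P} {l : ℝ} (hl : 0 < l)
    (hγ : HasUnitSpeedOn γ (Icc 0 l)) (hfin : ∫⁻ τ in Icc 0 l, g (γ τ) ≠ ∞) {s t : ℝ}
    (hs : s ∈ Icc 0 l) (ht : t ∈ Icc 0 l) (hst : s ≤ t) :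
    edist (u (γ s)).toReal (u (γ t)).toReal ≤ ∫⁻ τ in Icc s t, g (γ τ) := by
  rcases hst.eq_or_lt with rfl | hst
  · simp
  · rw [← ereal_abs_coe_sub_coe, ← h.eq_coe_toReal hl hγ hfin hs, ← h.eq_coe_toReal hl hγ hfin ht]
    exact h.abs_sub_le hγ hs.1 hst ht.2

-- The term `ε * g` excludes the curves along which `g` is not integrable, where `w` may jump.
theorem add_const_mul_of_forall_ne_zero {G : P → ℝ≥0∞} {L : ℝ≥0}
    (h : IsUpperGradient w fun x => g x + L) (hg : Measurable[borel P] g)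
    (hG : Measurable[borel P] G) (hle : ∀ x, w x ≠ 0 → g x + L ≤ G x) {ε : ℝ≥0} (hε : 0 < ε) :
    IsUpperGradient w fun x => G x + ε * g x := by
  refine ⟨hG.add (hg.const_mul _), fun l γ hl hγ => ?_⟩
  by_cases htop : ∫⁻ t in Icc 0 l, g (γ t) = ∞
  · calc (w (γ 0) - w (γ l)).abs ≤ ∫⁻ t in Icc 0 l, ε * g (γ t) := by
          rw [lintegral_const_mul' _ _ ENNReal.coe_ne_top, htop,
            ENNReal.mul_top (by exact_mod_cast hε.ne')]
          exact le_top
      _ ≤ ∫⁻ t in Icc 0 l, (G (γ t) + ε * g (γ t)) := lintegral_mono fun t => le_add_self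
  have hfin : ∫⁻ t in Icc 0 l, (g (γ t) + L) ≠ ∞ := by
    rw [lintegral_add_right _ measurable_const, setLIntegral_const, Real.volume_Icc]
    exact ENNReal.add_ne_top.2 ⟨htop, ENNReal.mul_ne_top ENNReal.coe_ne_top ENNReal.ofReal_ne_top⟩
  have hreal : ∀ t ∈ Icc 0 l, w (γ t) = (w (γ t)).toReal := fun t => h.eq_coe_toReal hl hγ hfin
  have hdist : ∀ s ∈ Icc 0 l, ∀ t ∈ Icc 0 l, s ≤ t →
      edist (w (γ s)).toReal (w (γ t)).toReal ≤ ∫⁻ τ in Icc s t, (g (γ τ) + L) :=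
    fun s hs t ht => h.edist_toReal_le hl hγ hfin hs ht
  calc (w (γ 0) - w (γ l)).abs = edist (w (γ 0)).toReal (w (γ l)).toReal := by
        rw [← ereal_abs_coe_sub_coe, ← hreal 0 (left_mem_Icc.2 hl.le),
          ← hreal l (right_mem_Icc.2 hl.le)]
    _ ≤ ∫⁻ t in Icc 0 l, G (γ t) :=
        edist_le_setLIntegral_of_forall_ne hl.le (continuousOn_of_edist_le_setLIntegral hfin hdist)
          hdist 0 fun t _ ht0 => hle _ fun h0 => ht0 (by rw [h0, EReal.toReal_zero])
    _ ≤ ∫⁻ t in Icc 0 l, (G (γ t) + ε * g (γ t)) := lintegral_mono fun t => le_self_add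

end IsUpperGradient

section NewtonianNorm

variable {P : Type*} [MetricSpace P] [MeasurableSpace P] {μ : Measure P}
  {N : (P → EReal) → ℝ≥0∞} {u w : P → EReal} {g : P → ℝ≥0∞} {L : ℝ≥0}

theorem newtonianNorm_le_of_abs_le (hX : IsBanachFunctionLattice μ N) (hu : AEMeasurable u μ)
    (hw : AEMeasurable w μ) (habs : ∀ x, (w x).abs ≤ (u x).abs)
    (hsub : ∀ x y, (w x - w y).abs ≤ (u x - u y).abs) :
    newtonianNorm N w ≤ newtonianNorm N u :=
  add_le_add (hX.lattice _ _ hw hu (Eventually.of_forall habs))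
    (le_iInf₂ fun g hg => iInf₂_le g (hg.of_abs_sub_le hsub))

theorem newtonianNorm_neg_le (hX : IsBanachFunctionLattice μ N) (hu : AEMeasurable u μ) :
    newtonianNorm N (fun x => -u x) ≤ newtonianNorm N u :=
  newtonianNorm_le_of_abs_le hX hu (measurable_neg.comp_aemeasurable hu)
    (fun _ => (EReal.abs_neg _).le) fun _ _ => (ereal_abs_neg_sub_neg _ _).le

theorem newtonianNorm_add_le [BorelSpace P] (hX : IsBanachFunctionLattice μ N)
    (hu : AEMeasurable u μ) (hw : AEMeasurable w μ) :
    newtonianNorm N (fun x => u x + w x) ≤ newtonianNorm N u + newtonianNorm N w := by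
  refine (add_le_add (hX.add_le u w hu hw) (ENNReal.le_iInf₂_add_iInf₂ fun g hg g' hg' => ?_)).trans
    (add_add_add_comm _ _ _ _).le
  exact (iInf₂_le _ (hg.add hg')).trans
    (hX.posNorm_add_le hg.measurable.aemeasurable hg'.measurable.aemeasurable)

theorem newtonianNorm_sub_le [BorelSpace P] (hX : IsBanachFunctionLattice μ N)
    (hu : AEMeasurable u μ) {v f : P → ℝ} (hv : AEMeasurable v μ) (hf : AEMeasurable f μ) :
    newtonianNorm N (fun x => u x - f x) ≤
      newtonianNorm N (fun x => u x - v x) +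
        newtonianNorm N fun x => ((v x - f x : ℝ) : EReal) := by
  simpa only [Pi.sub_apply, ereal_sub_add_coe_sub] using
    newtonianNorm_add_le hX (aemeasurable_ereal_sub_coe hu hv) (hv.sub hf).coe_real_ereal

theorem coe_mem_newtonianSpace_of_sub [BorelSpace P] (hX : IsBanachFunctionLattice μ N)
    {v f : P → ℝ} (hv : (fun x => (v x : EReal)) ∈ newtonianSpace μ N)
    (hvf : (fun x => ((v x - f x : ℝ) : EReal)) ∈ newtonianSpace μ N) :
    (fun x => (f x : EReal)) ∈ newtonianSpace μ N := by
  have hf : (fun x => (f x : EReal)) = fun x => (v x : EReal) + -((v x - f x : ℝ) : EReal) := by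
    ext x
    norm_cast
    ring
  have hneg := newtonianNorm_neg_le hX hvf.1
  have hneg_meas := measurable_neg.comp_aemeasurable hvf.1
  rw [hf]
  exact ⟨hv.1.add hneg_meas, (newtonianNorm_add_le hX hv.1 hneg_meas).trans_lt
    (ENNReal.add_lt_top.2 ⟨hv.2, hneg.trans_lt hvf.2⟩)⟩

theorem newtonianNorm_le_of_forall_notMem [BorelSpace P] (hX : IsBanachFunctionLattice μ N)
    (h : IsUpperGradient w fun x => g x + L) (hg : Measurable g) (hfin : posNorm N g < ∞)
    {T : Set P} (hT : MeasurableSet T) (hw : ∀ x ∉ T, w x = 0) :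
    newtonianNorm N w ≤ N w + posNorm N (T.indicator fun x => g x + L) := by
  have hG : Measurable (T.indicator fun x => g x + L) := (hg.add measurable_const).indicator hT
  refine add_le_add le_rfl (ENNReal.le_of_forall_pos_le_add fun δ hδ _ => ?_)
  lift posNorm N g to ℝ≥0 using hfin.ne with b hb
  set ε := δ / (b + 1)
  have hgrad : IsUpperGradient w fun x => T.indicator (fun x => g x + L) x + ε * g x := by
    rw [BorelSpace.measurable_eq (α := P)] at hg hG
    refine h.add_const_mul_of_forall_ne_zero hg hG (fun x hx => ?_) (by positivity)
    rw [indicator_of_mem (by_contra fun hxT => hx (hw x hxT))]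
  have hεb : (ε : ℝ≥0∞) * b ≤ δ := by
    rw [← ENNReal.coe_mul, ENNReal.coe_le_coe, div_mul_eq_mul_div]
    exact div_le_of_le_mul₀ (by positivity) (by positivity) (by gcongr; exact le_self_add)
  calc (⨅ (g : P → ℝ≥0∞) (_ : IsUpperGradient w g), posNorm N g)
      ≤ posNorm N (fun x => T.indicator (fun x => g x + L) x + ε * g x) := iInf₂_le _ hgrad
    _ ≤ posNorm N (T.indicator fun x => g x + L) + ε * posNorm N g := by
        rw [← hX.posNorm_const_mul hg.aemeasurable]
        exact hX.posNorm_add_le hG.aemeasurable (hg.const_mul _).aemeasurable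
    _ ≤ posNorm N (T.indicator fun x => g x + L) + δ := by rw [← hb]; gcongr

theorem newtonianNorm_le_of_abs_le_indicator [BorelSpace P] (hX : IsBanachFunctionLattice μ N)
    (h : IsUpperGradient w fun x => g x + L) (hg : Measurable g) (hfin : posNorm N g < ∞)
    (hw : AEMeasurable w μ) {F : Set P} (hF : NullMeasurableSet F μ) {b : P → ℝ≥0∞}
    (hb : AEMeasurable b μ) (hwb : ∀ᵐ x ∂μ, (w x).abs ≤ F.indicator b x) :
    newtonianNorm N w ≤
      posNorm N (F.indicator b) + posNorm N (F.indicator fun x => g x + L) := by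
  have hSF : (F ∪ {x | w x ≠ 0} : Set P) =ᵐ[μ] F := by
    filter_upwards [hwb] with x hx
    refine propext (or_iff_left_of_imp fun hwx => by_contra fun hxF => hwx ?_)
    simpa [indicator_of_notMem hxF] using hx
  set T := toMeasurable μ (F ∪ {x | w x ≠ 0})
  have hTF : T =ᵐ[μ] F := (hF.congr hSF.symm).toMeasurable_ae_eq.trans hSF
  have hT : MeasurableSet T := measurableSet_toMeasurable _ _
  have hwT : ∀ x ∉ T, w x = 0 := fun x hx =>
    by_contra fun hwx => hx (subset_toMeasurable μ _ (Or.inr hwx))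
  have hnorm : N w ≤ posNorm N (F.indicator b) := by
    rw [hX.eq_posNorm_abs hw]
    exact hX.posNorm_mono (measurable_ereal_abs.comp_aemeasurable hw) (hb.indicator₀ hF) hwb
  refine (newtonianNorm_le_of_forall_notMem hX h hg hfin hT hwT).trans (add_le_add hnorm ?_)
  exact (hX.posNorm_congr ((hg.add measurable_const).indicator hT).aemeasurable
    (indicator_ae_eq_of_ae_eq_set hTF)).le

end NewtonianNorm

section LipschitzOffMaximal

variable {P : Type*} [MetricSpace P] [MeasurableSpace P] {μ : Measure P}

theorem lipschitzOnWith_of_meanOscillation_le [IsLocallyFiniteMeasure μ] [μ.IsOpenPosMeasure]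
    {C : ℝ≥0} (hC : IsDoublingWith C μ) {v : P → ℝ}
    (hv : ∀ x r, IntegrableOn v (Metric.ball x r) μ) {S : Set P} {k M R : ℝ≥0} (hR : 0 < R)
    (hk : ∀ x ∈ S, |v x| ≤ k) (hS : ∀ x ∈ S, IsWeakLebesguePoint μ v x)
    (hosc : ∀ x ∈ S, ∀ ρ ∈ Ioc (0 : ℝ) R, meanOscillation μ v x ρ ≤ M * ENNReal.ofReal ρ) :
    LipschitzOnWith ((8 * C + 12 * C ^ 2 + 4 * C ^ 3) * M + 8 * k / R) v S := by
  intro x hx y hy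
  rcases eq_or_ne x y with rfl | hxy
  · simp
  rw [ENNReal.coe_add, add_mul]
  rcases le_total (4 * dist x y) R with hnear | hfar
  · refine le_add_right ?_
    simpa using edist_le_of_meanOscillation_le hC hv hnear (hS x hx) (hS y hy) (hosc x hx)
      (hosc y hy) (dist_pos.2 hxy)
  · refine le_add_left ?_
    have hR' : (0 : ℝ) < R := hR
    have hdist : dist (v x) (v y) ≤ (8 * k / R : ℝ≥0) * dist x y := by
      calc dist (v x) (v y) ≤ |v x| + |v y| := abs_sub _ _
        _ ≤ 2 * k * 1 := by linarith [hk x hx, hk y hy]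
        _ ≤ 2 * k * (4 * dist x y / R) := by
            gcongr
            exact (one_le_div hR').2 hfar
        _ = (8 * k / R : ℝ≥0) * dist x y := by push_cast; ring
    rw [edist_nndist, edist_nndist, ← ENNReal.coe_mul, ENNReal.coe_le_coe]
    exact_mod_cast hdist

namespace SupportsPoincare

theorem exists_meanOscillation_le (hPI : SupportsPoincare μ 1) :
    ∃ c R : ℝ≥0, 0 < R ∧ ∀ (v : P → ℝ) (g : P → ℝ≥0∞), AEMeasurable v μ →
      (∀ x r, IntegrableOn v (Metric.ball x r) μ) → IsUpperGradient (fun x => (v x : EReal)) g →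
      ∀ x, ∀ ρ ∈ Ioc (0 : ℝ) R,
        meanOscillation μ v x ρ ≤ c * maximalFunction μ 1 g x * ENNReal.ofReal ρ := by
  obtain ⟨c, lam, -, hlam, hPI⟩ := hPI
  lift lam to ℝ≥0 using zero_le_one.trans hlam
  have hlam0 : (0 : ℝ) < lam := one_pos.trans_le hlam
  refine ⟨2 * c, lam⁻¹, inv_pos.2 hlam0, fun v g hv hint hg x ρ hρ => ?_⟩
  have hvfin : ∀ (x : P) (r : ℝ), 0 < r → ∫⁻ y in Metric.ball x r, (v y : EReal).abs ∂μ < ∞ := by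
    intro x r _
    simp only [EReal.abs_def, ← Real.enorm_eq_ofReal_abs]
    exact (hint x r).2
  have hosc := hPI (fun x => (v x : EReal)) g hv.coe_real_ereal hvfin hg x ρ hρ.1
  simp only [EReal.toReal_coe, ereal_abs_coe_sub_coe, ENNReal.rpow_one, div_one] at hosc
  have hdiam : Metric.ediam (Metric.ball x ρ) ≤ 2 * ENNReal.ofReal ρ := by
    rw [← Metric.eball_ofReal]
    exact Metric.ediam_eball_le
  have hlamρ : lam * ρ ∈ Ioc (0 : ℝ) 1 := by
    refine ⟨mul_pos hlam0 hρ.1, ?_⟩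
    simpa [hlam0.ne'] using mul_le_mul_of_nonneg_left hρ.2 hlam0.le
  calc meanOscillation μ v x ρ
      ≤ c * Metric.ediam (Metric.ball x ρ) * ⨍⁻ y in Metric.ball x (lam * ρ), g y ∂μ := hosc
    _ ≤ c * (2 * ENNReal.ofReal ρ) * maximalFunction μ 1 g x := by
        gcongr
        exact le_iSup₂ (f := fun s (_ : s ∈ Ioc (0 : ℝ) 1) => ⨍⁻ y in Metric.ball x s, g y ∂μ) _
          hlamρ
    _ = (2 * c : ℝ≥0) * maximalFunction μ 1 g x * ENNReal.ofReal ρ := by push_cast; ring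

variable [IsLocallyFiniteMeasure μ] [μ.IsOpenPosMeasure] {C : ℝ≥0}

theorem exists_lipschitzOnWith (hPI : SupportsPoincare μ 1) (hC : IsDoublingWith C μ) :
    ∃ L : ℝ≥0, ∀ (v : P → ℝ) (g : P → ℝ≥0∞) (σ : ℝ≥0), AEMeasurable v μ → (∀ x, |v x| ≤ σ) →
      IsUpperGradient (fun x => (v x : EReal)) g →
      LipschitzOnWith (L * σ) v
        {x | maximalFunction μ 1 g x ≤ 2 * σ ∧ IsWeakLebesguePoint μ v x} := by
  obtain ⟨c, R, hR, hosc⟩ := hPI.exists_meanOscillation_le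
  refine ⟨(8 * C + 12 * C ^ 2 + 4 * C ^ 3) * (c * 2) + 8 / R, fun v g σ hv hσ hg => ?_⟩
  have hint := hC.integrableOn_ball_of_abs_le hv hσ
  set S := {x | maximalFunction μ 1 g x ≤ 2 * σ ∧ IsWeakLebesguePoint μ v x}
  have hoscS : ∀ x ∈ S, ∀ ρ ∈ Ioc (0 : ℝ) R,
      meanOscillation μ v x ρ ≤ (c * (2 * σ) : ℝ≥0) * ENNReal.ofReal ρ := by
    intro x hx ρ hρ
    refine (hosc v g hv hint hg x ρ hρ).trans ?_
    push_cast
    gcongr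
    exact hx.1
  convert lipschitzOnWith_of_meanOscillation_le hC hint hR (fun x _ => hσ x) (fun x hx => hx.2)
    hoscS using 1
  ring

end SupportsPoincare

theorem exists_lipschitzWith_eqOn_of_abs_le {P : Type*} [PseudoMetricSpace P] {v : P → ℝ}
    {S : Set P} {L : ℝ≥0} (h : LipschitzOnWith L v S) {k : ℝ} (hk0 : 0 ≤ k)
    (hk : ∀ x ∈ S, |v x| ≤ k) :
    ∃ f : P → ℝ, LipschitzWith L f ∧ (∀ x, |f x| ≤ k) ∧ EqOn v f S := by
  obtain ⟨f, hf, hfv⟩ := h.extend_real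
  refine ⟨fun x => max (min (f x) k) (-k), (hf.min_const k).max_const (-k), fun x => ?_,
    fun x hx => ?_⟩
  · exact abs_le.2 ⟨le_max_right _ _, max_le (min_le_right _ _) (by linarith)⟩
  · have hx_abs := abs_le.1 (hk x hx)
    change v x = max (min (f x) k) (-k)
    rw [← hfv hx, min_eq_left hx_abs.2, max_eq_left hx_abs.1]

theorem SupportsPoincare.exists_lipschitzWith_ae_eq_of_notMem [BorelSpace P]
    [SecondCountableTopology P] [IsLocallyFiniteMeasure μ] [μ.IsOpenPosMeasure] {C : ℝ≥0}
    (hPI : SupportsPoincare μ 1) (hC : IsDoublingWith C μ) :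
    ∃ L : ℝ≥0, ∀ (v : P → ℝ) (g : P → ℝ≥0∞) (σ : ℝ≥0), AEMeasurable v μ → (∀ x, |v x| ≤ σ) →
      IsUpperGradient (fun x => (v x : EReal)) g →
      ∀ E, {x | σ < maximalFunction μ 1 ({y | σ < g y}.indicator g) x} ⊆ E →
        ∃ f : P → ℝ, LipschitzWith (L * σ) f ∧ (∀ x, |f x| ≤ σ) ∧
          ∀ᵐ x ∂μ, x ∉ E → v x = f x := by
  obtain ⟨L, hL⟩ := hPI.exists_lipschitzOnWith hC
  refine ⟨L, fun v g σ hv hσ hg E hE => ?_⟩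
  obtain ⟨f, hf, hfσ, hfv⟩ :=
    exists_lipschitzWith_eqOn_of_abs_le (hL v g σ hv hσ hg) σ.coe_nonneg fun x _ => hσ x
  refine ⟨f, hf, hfσ, ?_⟩
  have hloc : LocallyIntegrable v μ := fun x =>
    ⟨_, Metric.ball_mem_nhds x one_pos, hC.integrableOn_ball_of_abs_le hv hσ x 1⟩
  filter_upwards [hC.ae_isWeakLebesguePoint hloc] with x hx hxE
  refine hfv ⟨?_, hx⟩
  calc maximalFunction μ 1 g x
      ≤ maximalFunction μ 1 ({y | σ < g y}.indicator g) x + σ :=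
        maximalFunction_le_add_of_le_add (le_indicator_lt_add g σ) x
    _ ≤ σ + σ := by
        gcongr
        exact not_lt.1 fun hlt => hxE (hE hlt)
    _ = 2 * σ := (two_mul _).symm

end LipschitzOffMaximal

section Truncation

/-- Truncation of an extended real number at the levels `±k`. -/
noncomputable def clamp (k : ℝ≥0) (a : EReal) : ℝ := (max (min a (k : ℝ)) (-k : ℝ)).toReal

theorem clamp_coe (k : ℝ≥0) (a : ℝ) : clamp k a = max (min a k) (-k) := by
  have hcoe : max (min (a : EReal) (k : ℝ)) (-k : ℝ) = (max (min a k) (-k) : ℝ) := by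
    rw [EReal.coe_strictMono.monotone.map_max, EReal.coe_strictMono.monotone.map_min]
  rw [clamp, hcoe, EReal.toReal_coe]

theorem measurable_clamp (k : ℝ≥0) : Measurable (clamp k) :=
  ((measurable_id.min measurable_const).max measurable_const).ereal_toReal

theorem abs_clamp_le (k : ℝ≥0) (a : EReal) : |clamp k a| ≤ k := by
  have hk := k.coe_nonneg
  induction a with
  | bot => simp [clamp]
  | top =>
    rw [clamp, min_eq_right le_top, max_eq_left (EReal.coe_le_coe_iff.2 (by linarith)),
      EReal.toReal_coe, abs_of_nonneg hk]
  | coe a =>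
    rw [clamp_coe, abs_le]
    exact ⟨le_max_right _ _, max_le (min_le_right _ _) (by linarith)⟩

theorem abs_clamp_sub_clamp_le (k : ℝ≥0) (a b : EReal) :
    ((clamp k a : EReal) - clamp k b).abs ≤ (a - b).abs := by
  rcases eq_or_ne (a - b).abs ∞ with htop | hfin
  · exact htop ▸ le_top
  · obtain ⟨ha, hb⟩ := ereal_eq_coe_toReal_of_abs_sub_lt_top hfin.lt_top
    rw [ha, hb, clamp_coe, clamp_coe, ← EReal.coe_sub, ← EReal.coe_sub, EReal.abs_def,
      EReal.abs_def]
    exact ENNReal.ofReal_le_ofReal (by grind)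

theorem abs_sub_clamp_sub_le (k : ℝ≥0) (a b : EReal) :
    (a - clamp k a - (b - clamp k b)).abs ≤ (a - b).abs := by
  have hk := k.coe_nonneg
  rcases eq_or_ne (a - b).abs ∞ with htop | hfin
  · exact htop ▸ le_top
  · obtain ⟨ha, hb⟩ := ereal_eq_coe_toReal_of_abs_sub_lt_top hfin.lt_top
    rw [ha, hb, clamp_coe, clamp_coe, ← EReal.coe_sub, ← EReal.coe_sub, ← EReal.coe_sub,
      ← EReal.coe_sub, EReal.abs_def, EReal.abs_def]
    exact ENNReal.ofReal_le_ofReal (by grind)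

theorem clamp_zero (k : ℝ≥0) : clamp k 0 = 0 := by
  simpa using clamp_coe k 0

theorem abs_clamp_le_abs (k : ℝ≥0) (a : EReal) : (clamp k a : EReal).abs ≤ a.abs := by
  simpa [clamp_zero] using abs_clamp_sub_clamp_le k a 0

theorem sub_clamp_eq_zero {k : ℝ≥0} {a : EReal} (h : a.abs ≤ k) : a - clamp k a = 0 := by
  induction a with
  | bot => simp at h
  | top => simp at h
  | coe a =>
    rw [EReal.abs_def, ENNReal.ofReal_le_iff_le_toReal ENNReal.coe_ne_top, ENNReal.coe_toReal,
      abs_le] at h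
    rw [clamp_coe, min_eq_left h.2, max_eq_left h.1, ← EReal.coe_sub, sub_self, EReal.coe_zero]

theorem abs_sub_clamp_le_indicator (k : ℝ≥0) {P : Type*} (u : P → EReal) (x : P) :
    (u x - clamp k (u x)).abs ≤ {x | k < (u x).abs}.indicator (fun x => (u x).abs) x := by
  by_cases hx : k < (u x).abs
  · rw [indicator_of_mem (show x ∈ {x | k < (u x).abs} from hx)]
    simpa [clamp_zero] using abs_sub_clamp_sub_le k (u x) 0
  · rw [sub_clamp_eq_zero (not_lt.1 hx), EReal.abs_zero]
    exact zero_le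

end Truncation

section AbsoluteContinuity

variable {P : Type*} [MeasurableSpace P] {μ : Measure P} [SigmaFinite μ] {N : (P → EReal) → ℝ≥0∞}

theorem IsBanachFunctionSpace.ae_lt_top (hX : IsBanachFunctionSpace μ N) {f : P → ℝ≥0∞}
    (hf : AEMeasurable f μ) (hfin : posNorm N f < ∞) : ∀ᵐ x ∂μ, f x < ∞ := by
  rw [← Measure.restrict_univ (μ := μ), ← iUnion_spanningSets μ, ae_restrict_iUnion_iff]
  intro n
  obtain ⟨C, -, hC⟩ := hX.lintegral_le (spanningSets μ n)
    (measurableSet_spanningSets μ n).nullMeasurableSet (measure_spanningSets_lt_top μ n)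
  have hint := hC _ hf.coe_ereal_ennreal
  simp only [ereal_abs_coe_ennreal] at hint
  exact ae_lt_top' hf.restrict
    (hint.trans_lt (ENNReal.mul_lt_top ENNReal.coe_lt_top hfin)).ne

theorem HasAbsolutelyContinuousNorm.tendsto_posNorm_indicator_lt
    (hAC : HasAbsolutelyContinuousNorm μ N) (hX : IsBanachFunctionSpace μ N) {f h : P → ℝ≥0∞}
    (hf : AEMeasurable f μ) (hfin : posNorm N f < ∞) (hh : AEMeasurable h μ)
    (hhfin : posNorm N h < ∞) :
    Tendsto (fun n : ℕ => posNorm N ({x | ((n : ℝ≥0) : ℝ≥0∞) < h x}.indicator f)) atTop (𝓝 0) := by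
  refine hAC.tendsto_posNorm_indicator hf hfin
    (fun n => nullMeasurableSet_lt aemeasurable_const hh) (fun m n hmn x hx => ?_) ?_
  · exact lt_of_le_of_lt (by gcongr) (show ((n : ℝ≥0) : ℝ≥0∞) < h x from hx)
  · refine measure_mono_null (fun x hx => ?_) (ae_iff.1 (hX.ae_lt_top hh hhfin))
    intro (hlt : h x < ∞)
    obtain ⟨n, hn⟩ := ENNReal.exists_nat_gt hlt.ne
    exact hn.not_gt (by simpa using mem_iInter.1 hx n)

end AbsoluteContinuity

section Density

variable {P : Type*} [MetricSpace P] [MeasurableSpace P] [BorelSpace P] {μ : Measure P}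
  {N : (P → EReal) → ℝ≥0∞}

theorem HasAbsolutelyContinuousNorm.tendsto_newtonianNorm_sub_clamp [SigmaFinite μ]
    (hAC : HasAbsolutelyContinuousNorm μ N) (hX : IsBanachFunctionSpace μ N)
    {u : P → EReal} (hu : AEMeasurable u μ) (hufin : N u < ∞) {g : P → ℝ≥0∞}
    (hg : IsUpperGradient u g) (hgfin : posNorm N g < ∞) :
    Tendsto (fun n : ℕ => newtonianNorm N fun x => u x - clamp n (u x)) atTop (𝓝 0) := by
  have hau : AEMeasurable (fun x => (u x).abs) μ := measurable_ereal_abs.comp_aemeasurable hu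
  rw [hX.eq_posNorm_abs hu] at hufin
  have hlim := (hAC.tendsto_posNorm_indicator_lt hX hau hufin hau hufin).add
    (hAC.tendsto_posNorm_indicator_lt hX hg.measurable.aemeasurable hgfin hau hufin)
  rw [add_zero] at hlim
  refine tendsto_of_tendsto_of_tendsto_of_le_of_le tendsto_const_nhds hlim (fun _ => zero_le)
    fun n => ?_
  have hgrad : IsUpperGradient (fun x => u x - clamp n (u x)) fun x => g x + (0 : ℝ≥0) := by
    simpa using hg.of_abs_sub_le fun x y => abs_sub_clamp_sub_le n (u x) (u y)
  simpa using newtonianNorm_le_of_abs_le_indicator hX.toIsBanachFunctionLattice hgrad hg.measurable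
    hgfin (aemeasurable_ereal_sub_coe hu ((measurable_clamp n).comp_aemeasurable hu))
    (nullMeasurableSet_lt aemeasurable_const hau) hau
    (Eventually.of_forall (abs_sub_clamp_le_indicator n u))

theorem HasAbsolutelyContinuousNorm.exists_bounded_newtonianNorm_sub_lt [SigmaFinite μ]
    (hAC : HasAbsolutelyContinuousNorm μ N) (hX : IsBanachFunctionSpace μ N)
    {u : P → EReal} (hu : u ∈ newtonianSpace μ N) {ε : ℝ≥0∞} (hε : 0 < ε) :
    ∃ (v : P → ℝ) (k : ℝ≥0), (∀ x, |v x| ≤ k) ∧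
      (fun x => (v x : EReal)) ∈ newtonianSpace μ N ∧
      newtonianNorm N (fun x => u x - v x) < ε := by
  obtain ⟨hum, hufin⟩ := hu
  obtain ⟨hNu, hgrad⟩ := ENNReal.add_lt_top.1 hufin
  simp only [iInf_lt_iff] at hgrad
  obtain ⟨g, hg, hgfin⟩ := hgrad
  obtain ⟨n, hn⟩ := ((hAC.tendsto_newtonianNorm_sub_clamp hX hum hNu hg hgfin).eventually
    (gt_mem_nhds hε)).exists
  have hvm : AEMeasurable (fun x => (clamp n (u x) : EReal)) μ :=
    ((measurable_clamp n).comp_aemeasurable hum).coe_real_ereal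
  exact ⟨fun x => clamp n (u x), n, fun x => abs_clamp_le n (u x), ⟨hvm,
    (newtonianNorm_le_of_abs_le hX.toIsBanachFunctionLattice hum hvm
      (fun x => abs_clamp_le_abs n (u x))
      fun x y => abs_clamp_sub_clamp_le n (u x) (u y)).trans_lt hufin⟩, hn⟩

theorem newtonianNorm_sub_le_of_ae_eq_of_notMem (hX : IsBanachFunctionLattice μ N)
    {v f : P → ℝ} {σ L : ℝ≥0} (hv : AEMeasurable v μ) (hvσ : ∀ x, |v x| ≤ σ)
    (hfσ : ∀ x, |f x| ≤ σ) (hf : LipschitzWith (L * σ) f) {g : P → ℝ≥0∞}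
    (hg : IsUpperGradient (fun x => (v x : EReal)) g) (hgfin : posNorm N g < ∞) {E : Set P}
    (hE : MeasurableSet E) (hvf : ∀ᵐ x ∂μ, x ∉ E → v x = f x) :
    newtonianNorm N (fun x => ((v x - f x : ℝ) : EReal)) ≤
      posNorm N ({x | σ < g x}.indicator g) + (3 + L) * (σ * posNorm N (E.indicator 1)) := by
  have hgrad : IsUpperGradient (fun x => ((v x - f x : ℝ) : EReal))
      fun x => g x + (L * σ : ℝ≥0) := by
    simpa [sub_eq_add_neg] using hg.add (IsUpperGradient.of_lipschitzWith hf.neg)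
  have habs : ∀ᵐ x ∂μ, ((v x - f x : ℝ) : EReal).abs ≤
      E.indicator (fun _ => ((2 * σ : ℝ≥0) : ℝ≥0∞)) x := by
    filter_upwards [hvf] with x hx
    by_cases hxE : x ∈ E
    · rw [indicator_of_mem hxE, EReal.abs_def, ENNReal.ofReal_le_iff_le_toReal ENNReal.coe_ne_top,
        ENNReal.coe_toReal]
      push_cast
      linarith [abs_sub (v x) (f x), hvσ x, hfσ x]
    · simp [hxE, hx hxE]
  calc newtonianNorm N (fun x => ((v x - f x : ℝ) : EReal))
      ≤ posNorm N (E.indicator fun _ => ((2 * σ : ℝ≥0) : ℝ≥0∞)) +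
          posNorm N (E.indicator fun x => g x + (L * σ : ℝ≥0)) :=
        newtonianNorm_le_of_abs_le_indicator hX hgrad hg.measurable hgfin
          (hv.sub hf.continuous.measurable.aemeasurable).coe_real_ereal hE.nullMeasurableSet
          aemeasurable_const habs
    _ ≤ (2 * σ : ℝ≥0) * posNorm N (E.indicator 1) + (posNorm N ({x | σ < g x}.indicator g) +
          (σ + (L * σ : ℝ≥0)) * posNorm N (E.indicator 1)) := by
        rw [hX.posNorm_indicator_const hE]
        gcongr
        exact hX.posNorm_indicator_add_const_le hg.measurable hE σ (L * σ)
    _ = posNorm N ({x | σ < g x}.indicator g) + (3 + L) * (σ * posNorm N (E.indicator 1)) := by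
        push_cast
        ring

section Lipschitz

variable [SecondCountableTopology P] [NullSingletonClass μ] [IsLocallyFiniteMeasure μ]
  [μ.IsOpenPosMeasure] {C : ℝ≥0}

theorem SupportsPoincare.exists_lipschitzWith_newtonianNorm_sub_le (hPI : SupportsPoincare μ 1)
    (hC : IsDoublingWith C μ) (hX : IsRearrangementInvariantSpace μ N) :
    ∃ A : ℝ≥0, ∀ (v : P → ℝ) (g : P → ℝ≥0∞) (σ : ℝ≥0), AEMeasurable v μ → (∀ x, |v x| ≤ σ) →
      IsUpperGradient (fun x => (v x : EReal)) g → posNorm N g < ∞ →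
      ∃ f : P → ℝ, (∃ K, LipschitzWith K f) ∧
        newtonianNorm N (fun x => ((v x - f x : ℝ) : EReal)) ≤
          A * posNorm N ({x | σ < g x}.indicator g) := by
  obtain ⟨L, hL⟩ := hPI.exists_lipschitzWith_ae_eq_of_notMem hC
  refine ⟨1 + (3 + L) * (⌈C ^ 3⌉₊ * 2), fun v g σ hv hvσ hg hgfin => ?_⟩
  set g₁ := {x | (σ : ℝ≥0∞) < g x}.indicator g
  have hg₁ : Measurable g₁ :=
    hg.measurable.indicator (measurableSet_lt measurable_const hg.measurable)
  obtain ⟨E, hE, hEsup, hEnorm⟩ :=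
    hX.exists_isOpen_superset_lt_maximalFunction hC hg₁.aemeasurable 1 σ
  obtain ⟨f, hf, hfσ, hvf⟩ := hL v g σ hv hvσ hg E hEsup
  refine ⟨f, ⟨_, hf⟩, ?_⟩
  calc newtonianNorm N (fun x => ((v x - f x : ℝ) : EReal))
      ≤ posNorm N g₁ + (3 + L) * (σ * posNorm N (E.indicator 1)) :=
        newtonianNorm_sub_le_of_ae_eq_of_notMem hX.toIsBanachFunctionLattice hv hvσ hfσ hf hg hgfin
          hE.measurableSet hvf
    _ ≤ posNorm N g₁ + (3 + L) * (⌈C ^ 3⌉₊ * (2 * posNorm N g₁)) :=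
        add_le_add le_rfl (mul_le_mul_right hEnorm _)
    _ = (1 + (3 + L) * (⌈C ^ 3⌉₊ * 2) : ℝ≥0) * posNorm N g₁ := by push_cast; ring

theorem SupportsPoincare.exists_lipschitzWith_newtonianNorm_sub_lt [SigmaFinite μ]
    (hPI : SupportsPoincare μ 1) (hC : IsDoublingWith C μ)
    (hX : IsRearrangementInvariantSpace μ N) (hAC : HasAbsolutelyContinuousNorm μ N) {v : P → ℝ}
    (hv : AEMeasurable v μ) {k : ℝ≥0} (hk : ∀ x, |v x| ≤ k)
    (hvfin : newtonianNorm N (fun x => (v x : EReal)) < ∞) {ε : ℝ≥0∞} (hε : 0 < ε) :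
    ∃ f : P → ℝ, (∃ K, LipschitzWith K f) ∧
      newtonianNorm N (fun x => ((v x - f x : ℝ) : EReal)) < ε := by
  have hgrad := (ENNReal.add_lt_top.1 hvfin).2
  simp only [iInf_lt_iff] at hgrad
  obtain ⟨g, hg, hgfin⟩ := hgrad
  obtain ⟨A, hA⟩ := hPI.exists_lipschitzWith_newtonianNorm_sub_le hC hX
  have hlim : Tendsto (fun n : ℕ => A * posNorm N ({x | ((n : ℝ≥0) : ℝ≥0∞) < g x}.indicator g))
      atTop (𝓝 0) := by
    simpa using ENNReal.Tendsto.const_mul (a := (A : ℝ≥0∞))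
      (hAC.tendsto_posNorm_indicator_lt hX.toIsBanachFunctionSpace hg.measurable.aemeasurable hgfin
        hg.measurable.aemeasurable hgfin) (Or.inr ENNReal.coe_ne_top)
  obtain ⟨n, hn, hkn⟩ := ((hlim.eventually (gt_mem_nhds hε)).and
    (eventually_ge_atTop ⌈k⌉₊)).exists
  have hvn : ∀ x, |v x| ≤ (n : ℝ≥0) := fun x =>
    (hk x).trans (NNReal.coe_le_coe.2 (Nat.ceil_le.1 hkn))
  obtain ⟨f, hf, hvf⟩ := hA v g n hv hvn hg hgfin
  exact ⟨f, hf, hvf.trans_lt hn⟩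

end Lipschitz

end Density

end NewtonianLip

theorem mainTheorem2 {P : Type*} [MetricSpace P] [MeasurableSpace P] [BorelSpace P]
    (μ : Measure P) [NullSingletonClass μ]
    (hball : ∀ (x : P) (r : ℝ), 0 < r → 0 < μ (Metric.ball x r) ∧ μ (Metric.ball x r) < ∞)
    (hdoubling : NewtonianLip.IsDoubling μ)
    (hPI : NewtonianLip.SupportsPoincare μ 1)
    (N : (P → EReal) → ℝ≥0∞)
    (hX : NewtonianLip.IsRearrangementInvariantSpace μ N)
    (hAC : NewtonianLip.HasAbsolutelyContinuousNorm μ N) :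
    ∀ u ∈ NewtonianLip.newtonianSpace μ N, ∀ ε : ℝ≥0∞, 0 < ε →
      ∃ f : P → ℝ, (∃ K : ℝ≥0, LipschitzWith K f) ∧
        (fun x => (f x : EReal)) ∈ NewtonianLip.newtonianSpace μ N ∧
        NewtonianLip.newtonianNorm N (fun x => u x - (f x : EReal)) < ε := by
  intro u hu ε hε
  obtain ⟨C, hC⟩ := hdoubling.exists_isDoublingWith
  have : μ.IsOpenPosMeasure :=
    NewtonianLip.isOpenPosMeasure_of_measure_ball_pos fun x r hr => (hball x r hr).1
  have : IsLocallyFiniteMeasure μ :=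
    ⟨fun x => ⟨_, Metric.ball_mem_nhds x one_pos, (hball x 1 one_pos).2⟩⟩
  have : SigmaFinite μ :=
    NewtonianLip.sigmaFinite_of_measure_ball_lt_top hC.measure_ball_lt_top
  have : SecondCountableTopology P :=
    NewtonianLip.secondCountableTopology_of_isOpenPosMeasure μ
  have hε2 : 0 < ε / 2 := ENNReal.half_pos hε.ne'
  obtain ⟨v, k, hvk, hv, huv⟩ :=
    hAC.exists_bounded_newtonianNorm_sub_lt hX.toIsBanachFunctionSpace hu hε2
  have hvm : AEMeasurable v μ := by simpa using hv.1.ereal_toReal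
  obtain ⟨f, ⟨K, hf⟩, hvf⟩ := hPI.exists_lipschitzWith_newtonianNorm_sub_lt hC hX hAC hvm hvk hv.2
    (lt_min hε2 ENNReal.zero_lt_top)
  have hfm : AEMeasurable f μ := hf.continuous.measurable.aemeasurable
  refine ⟨f, ⟨K, hf⟩, ?_, ?_⟩
  · exact NewtonianLip.coe_mem_newtonianSpace_of_sub hX.toIsBanachFunctionLattice hv
      ⟨(hvm.sub hfm).coe_real_ereal, hvf.trans_le (min_le_right _ _)⟩
  · rw [← ENNReal.add_halves ε]
    exact (NewtonianLip.newtonianNorm_sub_le hX.toIsBanachFunctionLattice hu.1 hvm hfm).trans_lt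
      (ENNReal.add_lt_add huv (hvf.trans_le (min_le_left _ _)))
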